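/- The background theory is $\mathsf{ZF}$ (no choice); that is, the following holds in every transitive class $M$ (a set or a proper class, for instance the universe $V$ itself) that is a model of $\mathsf{ZF}$, where $V_\alpha$, cofinality and "set" are meant in the sense of $M$. Let $\eta<\delta$ be limit ordinals, and let $j:V_\eta\to V_\delta$ be $\Sigma_1$-elementary (it preserves and reflects the truth of all $\Sigma_1$ formulas of the language of set theory) and $\in$-cofinal (for every $y\in V_\delta$ there is $x\in V_\eta$ with $y\in j(x)$). Then: 1. If $j:(V_\eta,\in)\to(V_\delta,\in)$ is fully elementary (for all first-order formulas), then $j$ is not definable over $V_\delta$ from parameters; that is, there are no formula $\varphi$ and no finite tuple $\vec p$ of elements of $V_\delta$ such that for all $x,y\in V_\delta$: $V_\delta\models\varphi(x,y,\vec p)$ if and only if $x\in V_\eta$ and $j(x)=y$. 2. If $\mu=\mathrm{cof}(\eta)<\eta$ and $j(\mu)=\mu$, then for every set $A\subseteq V_\eta$, defining $$j(A)=\bigcup_{\beta<\eta}j(A\cap V_\beta),$$ the map $j:(V_\eta,\in,A)\to(V_\delta,\in,j(A))$ is fully elementary, for the language of set theory with an additional unary predicate symbol interpreted by $A$ and by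 $j(A)$ respectively. -/

import Mathlib

universe u v w

namespace RankEmb

open FirstOrder FirstOrder.Language


/-! ### The language of set theory, and membership structures -/

/-- The only nonlogical symbol of the language of set theory: binary membership. -/
inductive SetRel : ℕ → Type
  | mem : SetRel 2

/-- The language of set theory. -/
def setLang : FirstOrder.Language.{0, 0} := ⟨fun _ => Empty, SetRel⟩

/-- The relation symbols of the language of set theory with one extra unary predicate. -/
inductive SetPredRel : ℕ → Type
  | mem : SetPredRel 2
  | pred : SetPredRel 1

/-- The language of set theory with one extra unary predicate symbol. -/
def setPredLang : FirstOrder.Language.{0, 0} := ⟨fun _ => Empty, SetPredRel⟩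

/-- A set or class `X` of sets as the structure `(X, ∈)`. -/
instance memStructure (X : Set ZFSet.{u}) : setLang.Structure X where
  funMap := fun f _ => nomatch f
  RelMap := fun R x =>
    match R with
    | SetRel.mem => (x 0 : ZFSet.{u}) ∈ (x 1 : ZFSet.{u})

/-- The structure `(X, ∈, A)`, in which the extra predicate symbol is interpreted by `A ∩ X`. -/
abbrev predStructure (X A : Set ZFSet.{u}) : setPredLang.Structure X where
  funMap := fun f _ => nomatch f
  RelMap := fun R x =>
    match R with
    | SetPredRel.mem => (x 0 : ZFSet.{u}) ∈ (x 1 : ZFSet.{u})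
    | SetPredRel.pred => (x 0 : ZFSet.{u}) ∈ A

/-! ### Elementarity -/

/-- The atomic formula `s ∈ t`. -/
def memFormula {α : Type} {n : ℕ} (s t : setLang.Term (α ⊕ Fin n)) :
    setLang.BoundedFormula α n :=
  BoundedFormula.rel (SetRel.mem : setLang.Relations 2) ![s, t]

/-- The `Δ₀` formulas: built from atomic formulas by the propositional connectives (generated by
falsum and implication) and bounded quantification `∀ z ∈ x`, where `x` is a variable already in
scope (and so different from `z`). The bounded `∃ z ∈ x` is `¬ ∀ z ∈ x ¬`. -/
inductive IsDelta0 {α : Type} : ∀ {n : ℕ}, setLang.BoundedFormula α n → Prop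
  | falsum {n : ℕ} : IsDelta0 (BoundedFormula.falsum (n := n))
  | equal {n : ℕ} (s t : setLang.Term (α ⊕ Fin n)) : IsDelta0 (BoundedFormula.equal s t)
  | mem {n : ℕ} (s t : setLang.Term (α ⊕ Fin n)) : IsDelta0 (memFormula s t)
  | imp {n : ℕ} {φ ψ : setLang.BoundedFormula α n} :
      IsDelta0 φ → IsDelta0 ψ → IsDelta0 (φ.imp ψ)
  | ball {n : ℕ} (x : α ⊕ Fin n) {φ : setLang.BoundedFormula α (n + 1)} :
      IsDelta0 φ →
      IsDelta0 (((memFormula (Term.var (Sum.inr (Fin.last n)))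
        (Term.var (Sum.map id Fin.castSucc x))).imp φ).all)

/-- The `Σ₁` formulas `∃ x₁ … ∃ xₖ ψ` with `ψ` a `Δ₀` formula. -/
inductive IsSigma1 {α : Type} : ∀ {n : ℕ}, setLang.BoundedFormula α n → Prop
  | of_delta0 {n : ℕ} {φ : setLang.BoundedFormula α n} : IsDelta0 φ → IsSigma1 φ
  | ex {n : ℕ} {φ : setLang.BoundedFormula α (n + 1)} : IsSigma1 φ → IsSigma1 φ.ex

/-- `f` is `Σ₁`-elementary from `(X, ∈)` to `(Y, ∈)`. -/
def IsSigma1Elementary {X Y : Set ZFSet.{u}} (f : X → Y) : Prop :=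
  ∀ (n : ℕ) (φ : setLang.Formula (Fin n)), IsSigma1 φ →
    ∀ x : Fin n → X, φ.Realize x ↔ φ.Realize (f ∘ x)

/-- `f` is (fully) elementary between two structures for the language `L`. -/
def IsElementary (L : FirstOrder.Language.{0, 0}) {X : Type v} {Y : Type w} [L.Structure X] [L.Structure Y]
    (f : X → Y) : Prop :=
  ∀ (n : ℕ) (φ : L.Formula (Fin n)) (x : Fin n → X), φ.Realize x ↔ φ.Realize (f ∘ x)

/-- `f` is fully elementary from `(X, ∈, A)` to `(Y, ∈, B)`. -/
def IsPredElementary {X Y : Set ZFSet.{u}} (A B : Set ZFSet.{u}) (f : X → Y) : Prop :=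
  @IsElementary setPredLang X Y (predStructure X A) (predStructure Y B) f

/-- `f : X → Y` is `∈`-cofinal: every element of `Y` belongs to some value of `f`. -/
def IsMemCofinal {X Y : Set ZFSet.{u}} (f : X → Y) : Prop :=
  ∀ y : Y, ∃ x : X, (y : ZFSet.{u}) ∈ (f x : ZFSet.{u})

/-! ### Transitive models of ZF, and notions relativized to them -/

/-- `M` is a transitive model of `ZF` (a set or a proper class; no form of choice is assumed).
Extensionality and foundation hold automatically in a transitive class. The schemes of separation
and collection are for formulas of the language of set theory, interpreted in `(M, ∈)`, with
arbitrary parameters from `M`. -/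
structure IsTransitiveZFModel (M : Set ZFSet.{u}) : Prop where
  transitive : ∀ x ∈ M, ∀ y ∈ x, y ∈ M
  pairing : ∀ x ∈ M, ∀ y ∈ M, ({x, y} : ZFSet.{u}) ∈ M
  union : ∀ x ∈ M, (ZFSet.sUnion x) ∈ M
  infinity : ∃ w ∈ M, ∅ ∈ w ∧ ∀ x ∈ w, insert x x ∈ w
  powerset : ∀ x ∈ M, ∃ p ∈ M, ∀ y ∈ M, y ∈ p ↔ y ⊆ x
  separation : ∀ D : Set M, (Set.univ : Set M).Definable₁ setLang D →
    ∀ a ∈ M, ∃ b ∈ M, ∀ x : M, (x : ZFSet.{u}) ∈ b ↔ (x : ZFSet.{u}) ∈ a ∧ x ∈ D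
  collection : ∀ R : Set (M × M), (Set.univ : Set M).Definable₂ setLang R →
    ∀ a ∈ M, (∀ x : M, (x : ZFSet.{u}) ∈ a → ∃ y : M, (x, y) ∈ R) →
      ∃ b ∈ M, ∀ x : M, (x : ZFSet.{u}) ∈ a → ∃ y : M, (y : ZFSet.{u}) ∈ b ∧ (x, y) ∈ R

/-- The universe of all sets is a transitive model of `ZF`. -/
theorem isTransitiveZFModel_univ : IsTransitiveZFModel (Set.univ : Set ZFSet.{u}) where
  transitive := fun _ _ _ _ => trivial
  pairing := fun _ _ _ _ => trivial
  union := fun _ _ => trivial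
  infinity := ⟨ZFSet.omega, trivial, ZFSet.omega_zero, fun _ hx => ZFSet.omega_succ hx⟩
  powerset := fun x _ => ⟨ZFSet.powerset x, trivial, fun _ _ => ZFSet.mem_powerset⟩
  separation := fun D _ a _ =>
    ⟨ZFSet.sep (fun x => (⟨x, trivial⟩ : (Set.univ : Set ZFSet.{u})) ∈ D) a, trivial,
      fun _ => ZFSet.mem_sep⟩
  collection := by
    intro R _ a _ h
    choose g hg using fun x : a => h ⟨x, trivial⟩ x.2
    refine ⟨ZFSet.range (fun x : a => (g x : ZFSet.{u})), trivial, fun x hx => ?_⟩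
    exact ⟨g ⟨x, hx⟩, ZFSet.mem_range.2 ⟨⟨x, hx⟩, rfl⟩, hg ⟨x, hx⟩⟩

/-- The level `V_α` of the cumulative hierarchy as computed in the transitive model `M`, which is
`V_α ∩ M` because rank is absolute. -/
def rankLevel (M : Set ZFSet.{u}) (α : Ordinal.{u}) : Set ZFSet.{u} :=
  {x | x ∈ M ∧ x ∈ ZFSet.vonNeumann α}

/-- `μ` is the cofinality of `η` in the sense of `M`: the least `α` such that some function
`f : α → η` in `M` has range cofinal in `η`. (An ordinal `α` is identified with the von Neumann
ordinal `α.toZFSet`.) -/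
def IsCofIn (M : Set ZFSet.{u}) (η μ : Ordinal.{u}) : Prop :=
  IsLeast {α : Ordinal.{u} | ∃ f ∈ M, ZFSet.IsFunc α.toZFSet η.toZFSet f ∧
    ∀ β < η, ∃ ξ < α, ∃ γ < η, β ≤ γ ∧ ZFSet.pair ξ.toZFSet γ.toZFSet ∈ f} μ

/-- The graph of `j : V_η → V_δ`, as a subset of `V_δ × V_δ` (for `η ≤ δ`). -/
def graphOn {M : Set ZFSet.{u}} {η δ : Ordinal.{u}} (j : rankLevel M η → rankLevel M δ) :
    Set (rankLevel M δ × rankLevel M δ) :=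
  {p | ∃ x : rankLevel M η, (x : ZFSet.{u}) = (p.1 : ZFSet.{u}) ∧ j x = p.2}

/-- `j(A) = ⋃_{β < η} j(A ∩ V_β)`, for `A ⊆ V_η`. -/
def imageOf {M : Set ZFSet.{u}} {η δ : Ordinal.{u}} (j : rankLevel M η → rankLevel M δ)
    (A : ZFSet.{u}) : Set ZFSet.{u} :=
  {y | ∃ β < η, ∃ x : rankLevel M η,
    (x : ZFSet.{u}) = A ∩ ZFSet.vonNeumann β ∧ y ∈ (j x : ZFSet.{u})}

end RankEmb

/-! Both parts rest on one transfer argument. Let `J` send a class `X` into a transitive class `Y`,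
be ∈-cofinal and preserve a finite list of `Δ₀` predicates. Tuples are coded by sets, and induction
on a formula, treated together with its negation, shows: if `x ∈ X` is a set of codes of tuples
satisfying the formula in `X`, then every element of `J x` codes a tuple satisfying it in `Y`
(`Transfers`). Singletons `x` give full elementarity. The truth sets over `X` lie in `M`, so cutting
`x` down by them stays inside `X`; the map itself need not lie in `M`.

A universal quantifier uses cofinality: each `y ∈ Y` lies in some `J w`. An existential one is
harder, as witnesses for the members of `x` may be unbounded in `X`. Here `X` is an increasing union
of bounded pieces indexed by an ordinal `μ` with `J μ = μ`. Let `C` be the set of pairs `(ξ, s)`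
such that `s ∈ x` has a witness in piece `ξ`. A member `t` of `J x` has `(ξ, t) ∈ J C` for some `ξ <
J μ = μ`; since `ξ ≤ J ξ`, monotonicity gives `(J ξ, t) ∈ J C`. Piece `ξ` is contained in some `w ∈
X`, so `t` has a witness in `J w` (`transfers_ex`). For part 2, a cofinal `f : μ → η` gives the
pieces `⋃_{ζ ≤ ξ} V_{f(ζ)}`.

For part 1, suppose that a formula `φ` with parameters defines `j` over `V_δ`. Call `a` a length if,
for some parameters and some `F`, applying the relation given by `φ` to the values of `F` yields a
filtration of the universe of length `a`. The image under `j` of a filtration of `V_η` is one of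
`V_δ` with the same indices. So if `μ` is the least length in `V_η`, then `μ` is also a length in
`V_δ`, where `j μ` is least; hence `j μ = μ`. Now "critical point of a map given by `φ` on a closed
set, preserving the clauses and fixing the length of a filtration" is first-order, and the transfer
argument makes every such map elementary. The least critical point `κ` is then definable without
parameters, hence in the range of a map with critical point `κ`, which is impossible
(`not_isCriticalPoint`). -/

namespace RankEmb

open FirstOrder FirstOrder.Language

/-! ### Calculus of `Δ₀` predicates -/

/-- A class that contains the elements of its elements. -/
def IsTransClass (X : Set ZFSet.{u}) : Prop := ∀ x ∈ X, ∀ y ∈ x, y ∈ X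

/-- A projection to one of the free or bound variables. -/
class IsVar {α : Type} {n : ℕ} (t : (α → ZFSet.{u}) → (Fin n → ZFSet.{u}) → ZFSet.{u}) : Prop where
  exists_eq : ∃ s : α ⊕ Fin n, ∀ v xs, t v xs = Sum.elim v xs s

/-- A predicate that is expressed by one `Δ₀` formula in every transitive class. -/
class D0 {α : Type} {n : ℕ} (P : (α → ZFSet.{u}) → (Fin n → ZFSet.{u}) → Prop) : Prop where
  exists_formula : ∃ φ : setLang.BoundedFormula α n, IsDelta0 φ ∧
    ∀ X : Set ZFSet.{u}, IsTransClass X → ∀ (v : α → X) (xs : Fin n → X),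
      φ.Realize v xs ↔ P (fun a => v a) (fun i => xs i)

section D0

variable {α : Type} {n : ℕ} {s t r p : (α → ZFSet.{u}) → (Fin n → ZFSet.{u}) → ZFSet.{u}}
  {P Q : (α → ZFSet.{u}) → (Fin n → ZFSet.{u}) → Prop}

instance IsVar.free (a : α) : IsVar (n := n) (fun v _ => (v a : ZFSet.{u})) := ⟨Sum.inl a, fun _ _ => rfl⟩

instance IsVar.bound (i : Fin n) : IsVar (α := α) (fun _ xs => (xs i : ZFSet.{u})) :=
  ⟨Sum.inr i, fun _ _ => rfl⟩

/-- Weakening by one bound variable; it is applied once for each bounded quantifier under which the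
term is used. -/
theorem IsVar.lift [h : IsVar t] :
    IsVar (n := n + 1) (fun v xs => t v (fun i => xs i.castSucc)) := by
  obtain ⟨a, ha⟩ := h
  refine ⟨Sum.map id Fin.castSucc a, fun v xs => ?_⟩
  rw [ha]
  cases a <;> rfl

theorem realize_memFormula {X : Set ZFSet.{u}} (a b : setLang.Term (α ⊕ Fin n))
    (v : α → X) (xs : Fin n → X) :
    (memFormula a b).Realize v xs ↔ ((a.realize (Sum.elim v xs) : X) : ZFSet.{u}) ∈
      ((b.realize (Sum.elim v xs) : X) : ZFSet.{u}) := by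
  rfl

theorem coe_elim {X : Set ZFSet.{u}} (v : α → X) (xs : Fin n → X) (a : α ⊕ Fin n) :
    ((Sum.elim v xs a : X) : ZFSet.{u}) = Sum.elim (fun a => (v a : ZFSet.{u})) (fun i => xs i) a := by
  cases a <;> rfl

theorem D0.congr (h : D0 P) (hPQ : ∀ v xs, Q v xs ↔ P v xs) : D0 Q := by
  rwa [show Q = P from funext₂ fun v xs => propext (hPQ v xs)]

instance D0.false : D0 (α := α) (n := n) (fun (_ : α → ZFSet.{u}) _ => False) :=
  ⟨BoundedFormula.falsum, .falsum, fun _ _ _ _ => Iff.rfl⟩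

instance D0.mem [hs : IsVar s] [ht : IsVar t] : D0 (fun v xs => s v xs ∈ t v xs) := by
  obtain ⟨a, ha⟩ := hs
  obtain ⟨b, hb⟩ := ht
  refine ⟨memFormula (.var a) (.var b), .mem _ _, fun X hX v xs => ?_⟩
  rw [realize_memFormula, ha, hb]
  simp [coe_elim]

instance D0.eq [hs : IsVar s] [ht : IsVar t] : D0 (fun v xs => s v xs = t v xs) := by
  obtain ⟨a, ha⟩ := hs
  obtain ⟨b, hb⟩ := ht
  refine ⟨.equal (.var a) (.var b), .equal _ _, fun X hX v xs => ?_⟩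
  rw [ha, hb]
  simp [BoundedFormula.Realize, ← coe_elim, Subtype.ext_iff]

instance D0.imp [hP : D0 P] [hQ : D0 Q] : D0 (fun v xs => P v xs → Q v xs) := by
  obtain ⟨φ, hφ, h⟩ := hP
  obtain ⟨ψ, hψ, h'⟩ := hQ
  refine ⟨φ.imp ψ, hφ.imp hψ, fun X hX v xs => ?_⟩
  rw [BoundedFormula.realize_imp, h X hX, h' X hX]

instance D0.not [hP : D0 P] : D0 (fun v xs => ¬ P v xs) := D0.imp (P := P)

instance D0.and [hP : D0 P] [hQ : D0 Q] : D0 (fun v xs => P v xs ∧ Q v xs) :=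
  (inferInstance : D0 (fun v xs => ¬ (P v xs → ¬ Q v xs))).congr fun _ _ => by tauto

instance D0.or [hP : D0 P] [hQ : D0 Q] : D0 (fun v xs => P v xs ∨ Q v xs) :=
  (inferInstance : D0 (fun v xs => ¬ P v xs → Q v xs)).congr fun _ _ => by tauto

instance D0.iff [hP : D0 P] [hQ : D0 Q] : D0 (fun v xs => P v xs ↔ Q v xs) :=
  (inferInstance : D0 (fun v xs => (P v xs → Q v xs) ∧ (Q v xs → P v xs))).congr
    fun _ _ => by tauto

instance D0.ball {R : (α → ZFSet.{u}) → (Fin n → ZFSet.{u}) → ZFSet.{u} → Prop}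
    [ht : IsVar t] [hR : D0 (fun v (xs : Fin (n + 1) → ZFSet.{u}) =>
      R v (fun i => xs i.castSucc) (xs (Fin.last n)))] :
    D0 (fun v xs => ∀ z ∈ t v xs, R v xs z) := by
  obtain ⟨a, ha⟩ := ht
  obtain ⟨φ, hφ, h⟩ := hR
  refine ⟨_, .ball a hφ, fun X hX v xs => ?_⟩
  simp only [BoundedFormula.realize_all, BoundedFormula.realize_imp, realize_memFormula,
    h X hX, Term.realize_var, Sum.elim_inr, Fin.snoc_last, Fin.snoc_castSucc, ha]
  have e : ∀ x : X, ((Sum.elim v (Fin.snoc xs x : Fin (n + 1) → X) (Sum.map id Fin.castSucc a) : X) :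
      ZFSet.{u}) = Sum.elim (fun a => (v a : ZFSet.{u})) (fun i => xs i) a := by
    intro x
    cases a <;> simp
  simp only [e]
  -- Transitivity of `X` makes the relativized bounded quantifier range over all members of the
  -- bounding set, so the formula means the same in every `X`.
  refine ⟨fun H z hz => H ⟨z, ?_⟩ hz, fun H z hz => H z hz⟩
  rw [← coe_elim] at hz
  exact hX _ (Subtype.coe_prop _) _ hz

instance D0.bex {R : (α → ZFSet.{u}) → (Fin n → ZFSet.{u}) → ZFSet.{u} → Prop}
    [ht : IsVar t] [hR : D0 (fun v (xs : Fin (n + 1) → ZFSet.{u}) =>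
      R v (fun i => xs i.castSucc) (xs (Fin.last n)))] :
    D0 (fun v xs => ∃ z ∈ t v xs, R v xs z) :=
  (inferInstance : D0 (fun v xs => ¬ ∀ z ∈ t v xs, ¬ R v xs z)).congr fun _ _ => by
    push Not; rfl

instance D0.subset [ht : IsVar t] [hs : IsVar s] : D0 (fun v xs => s v xs ⊆ t v xs) := by
  have := @IsVar.lift _ _ t ht
  exact (inferInstance : D0 (fun v xs => ∀ z ∈ s v xs, z ∈ t v xs)).congr fun _ _ => Iff.rfl

instance D0.isOrdinal [ht : IsVar t] : D0 (fun v xs => (t v xs).IsOrdinal) := by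
  have := @IsVar.lift _ _ t ht
  refine (inferInstance : D0 (fun v xs => (∀ y ∈ t v xs, y ⊆ t v xs) ∧
    ∀ y ∈ t v xs, ∀ z ∈ y, z ⊆ y)).congr fun _ _ => ?_
  rw [ZFSet.isOrdinal_iff_forall_mem_isTransitive]
  rfl

/-- `z = {x, y}` -/
instance D0.eq_upair [ht : IsVar t] [hs : IsVar s] [hr : IsVar r] :
    D0 (fun v xs => t v xs = {s v xs, r v xs}) := by
  have := @IsVar.lift _ _ t ht
  have := @IsVar.lift _ _ s hs
  have := @IsVar.lift _ _ r hr
  refine (inferInstance : D0 (fun v xs => s v xs ∈ t v xs ∧ r v xs ∈ t v xs ∧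
    ∀ y ∈ t v xs, y = s v xs ∨ y = r v xs)).congr fun _ _ => ?_
  constructor
  · intro h
    rw [h]
    simp
  · rintro ⟨h1, h2, h3⟩
    ext z
    simp only [ZFSet.mem_pair]
    refine ⟨h3 z, ?_⟩
    rintro (rfl | rfl) <;> assumption

instance D0.eq_pair [ht : IsVar t] [hs : IsVar s] [hr : IsVar r] :
    D0 (fun v xs => t v xs = ZFSet.pair (s v xs) (r v xs)) := by
  have := @IsVar.lift _ _ t ht
  have := @IsVar.lift _ _ s hs
  have := @IsVar.lift _ _ r hr
  have := @IsVar.lift _ _ (fun v xs => t v (fun i => xs i.castSucc)) inferInstance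
  have := @IsVar.lift _ _ (fun v xs => s v (fun i => xs i.castSucc)) inferInstance
  have := @IsVar.lift _ _ (fun v xs => r v (fun i => xs i.castSucc)) inferInstance
  have := @IsVar.lift _ _ (fun v xs => t v (fun i => xs i.castSucc.castSucc)) inferInstance
  -- Both Kuratowski components are elements of the pair, so the quantifiers over them are bounded.
  refine (inferInstance : D0 (fun v xs => ∃ a ∈ t v xs, a = {s v xs, s v xs} ∧
    ∃ b ∈ t v xs, b = {s v xs, r v xs} ∧ ∀ y ∈ t v xs, y = a ∨ y = b)).congr fun v xs => ?_
  constructor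
  · intro h
    rw [h, ZFSet.pair]
    exact ⟨{s v xs}, by simp, by simp, {s v xs, r v xs}, by simp, rfl, by simp⟩
  · rintro ⟨_, h1, rfl, _, h2, rfl, h3⟩
    ext z
    simp only [ZFSet.pair_eq_singleton] at h1 h3
    simp only [ZFSet.pair, ZFSet.mem_pair]
    refine ⟨h3 z, ?_⟩
    rintro (rfl | rfl) <;> assumption

instance D0.pair_mem [ht : IsVar t] [hs : IsVar s] [hr : IsVar r] :
    D0 (fun v xs => ZFSet.pair (s v xs) (r v xs) ∈ t v xs) := by
  have := @IsVar.lift _ _ t ht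
  have := @IsVar.lift _ _ s hs
  have := @IsVar.lift _ _ r hr
  exact (inferInstance : D0 (fun v xs => ∃ z ∈ t v xs, z = ZFSet.pair (s v xs) (r v xs))).congr
    fun _ _ => by simp

/-- `x = {(c, y)} ∪ z` -/
instance D0.eq_insert_pair [ht : IsVar t] [hs : IsVar s] [hr : IsVar r] [hp : IsVar p] :
    D0 (fun v xs => t v xs = insert (ZFSet.pair (s v xs) (r v xs)) (p v xs)) := by
  have := @IsVar.lift _ _ t ht
  have := @IsVar.lift _ _ s hs
  have := @IsVar.lift _ _ r hr
  have := @IsVar.lift _ _ p hp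
  refine (inferInstance : D0 (fun v xs => ZFSet.pair (s v xs) (r v xs) ∈ t v xs ∧
    (∀ a ∈ p v xs, a ∈ t v xs) ∧ ∀ a ∈ t v xs, a = ZFSet.pair (s v xs) (r v xs) ∨ a ∈ p v xs)).congr
    fun _ _ => ?_
  constructor
  · intro h
    rw [h]
    simp +contextual
  · rintro ⟨h1, h2, h3⟩
    ext z
    simp only [ZFSet.mem_insert_iff]
    refine ⟨h3 z, ?_⟩
    rintro (rfl | h)
    exacts [h1, h2 _ h]

end D0

/-! ### Calculus of uniformly definable predicates -/

/-- A predicate that is expressed by one first-order formula in every transitive class. -/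
class Def {α : Type} (P : ∀ X : Set ZFSet.{u}, (α → X) → Prop) : Prop where
  exists_formula : ∃ φ : setLang.Formula α, ∀ X : Set ZFSet.{u}, IsTransClass X →
    ∀ v : α → X, φ.Realize v ↔ P X v

section Def

variable {α β : Type} {P Q : ∀ X : Set ZFSet.{u}, (α → X) → Prop}

theorem Def.congr (h : Def P) (hPQ : ∀ X, IsTransClass X → ∀ v, Q X v ↔ P X v) : Def Q := by
  obtain ⟨φ, hφ⟩ := h
  exact ⟨φ, fun X hX v => (hφ X hX v).trans (hPQ X hX v).symm⟩

instance Def.imp [hP : Def P] [hQ : Def Q] : Def (fun X v => P X v → Q X v) := by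
  obtain ⟨φ, hφ⟩ := hP
  obtain ⟨ψ, hψ⟩ := hQ
  exact ⟨φ.imp ψ, fun X hX v => by rw [← hφ X hX, ← hψ X hX, Formula.realize_imp]⟩

instance Def.not [hP : Def P] : Def (fun X v => ¬ P X v) := by
  obtain ⟨φ, hφ⟩ := hP
  exact ⟨φ.not, fun X hX v => by rw [← hφ X hX, Formula.realize_not]⟩

instance Def.and [hP : Def P] [hQ : Def Q] : Def (fun X v => P X v ∧ Q X v) :=
  (inferInstance : Def (fun X v => ¬ (P X v → ¬ Q X v))).congr fun _ _ _ => by tauto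

instance Def.iff [hP : Def P] [hQ : Def Q] : Def (fun X v => P X v ↔ Q X v) :=
  (inferInstance : Def (fun X v => (P X v → Q X v) ∧ (Q X v → P X v))).congr
    fun _ _ _ => by tauto

instance Def.ex {R : ∀ X : Set ZFSet.{u}, (α → X) → X → Prop}
    [hR : Def (fun X (w : α ⊕ Fin 1 → X) => R X (fun a => w (Sum.inl a)) (w (Sum.inr 0)))] :
    Def (fun X v => ∃ x : X, R X v x) := by
  obtain ⟨φ, hφ⟩ := hR
  refine ⟨φ.iExs (Fin 1), fun X hX v => ?_⟩
  rw [Formula.realize_iExs]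
  simp only [hφ X hX]
  exact ⟨fun ⟨i, hi⟩ => ⟨i 0, hi⟩, fun ⟨x, hx⟩ => ⟨fun _ => x, hx⟩⟩

instance Def.all {R : ∀ X : Set ZFSet.{u}, (α → X) → X → Prop}
    [hR : Def (fun X (w : α ⊕ Fin 1 → X) => R X (fun a => w (Sum.inl a)) (w (Sum.inr 0)))] :
    Def (fun X v => ∀ x : X, R X v x) :=
  (inferInstance : Def (fun X v => ¬ ∃ x : X, ¬ R X v x)).congr fun _ _ _ => by push Not; rfl

instance Def.exTuple [Finite β] {R : ∀ X : Set ZFSet.{u}, (α → X) → (β → X) → Prop}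
    [hR : Def (fun X (w : α ⊕ β → X) => R X (fun a => w (Sum.inl a)) (fun b => w (Sum.inr b)))] :
    Def (fun X v => ∃ p : β → X, R X v p) := by
  obtain ⟨φ, hφ⟩ := hR
  refine ⟨φ.iExs β, fun X hX v => ?_⟩
  rw [Formula.realize_iExs]
  simp only [hφ X hX]
  rfl

instance Def.allTuple [Finite β] {R : ∀ X : Set ZFSet.{u}, (α → X) → (β → X) → Prop}
    [hR : Def (fun X (w : α ⊕ β → X) => R X (fun a => w (Sum.inl a)) (fun b => w (Sum.inr b)))] :
    Def (fun X v => ∀ p : β → X, R X v p) :=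
  (inferInstance : Def (fun X v => ¬ ∃ p : β → X, ¬ R X v p)).congr fun _ _ _ => by push Not; rfl

/-- Used with the finite type `Clause`: preservation of all clauses becomes a single first-order
formula, which preservation of all `Δ₀` formulas is not, without a satisfaction predicate. -/
instance Def.allFinite {ι : Type} [Finite ι] {R : ι → ∀ X : Set ZFSet.{u}, (α → X) → Prop}
    [hR : ∀ i, Def (R i)] : Def (fun X v => ∀ i, R i X v) := by
  choose φ hφ using fun i => (hR i).exists_formula
  refine ⟨Formula.iInf φ, fun X hX v => ?_⟩
  rw [Formula.realize_iInf]
  exact forall_congr' fun i => hφ i X hX v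

theorem Def.of_d0 {n : ℕ} (R : (β → ZFSet.{u}) → (Fin n → ZFSet.{u}) → Prop) [hR : D0 R]
    (g : β → α) (h : Fin n → α) :
    Def (fun _ v => R (fun b => v (g b)) (fun i => v (h i))) := by
  obtain ⟨φ, -, hφ⟩ := hR
  refine ⟨φ.toFormula.relabel (Sum.elim g h), fun X hX v => ?_⟩
  rw [Formula.realize_relabel, BoundedFormula.realize_toFormula, hφ X hX]
  rfl

instance Def.mem (a b : α) : Def (fun _ v => (v a : ZFSet.{u}) ∈ (v b : ZFSet.{u})) :=
  Def.of_d0 (fun w _ => w a ∈ w b) id Fin.elim0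

instance Def.eq (a b : α) : Def (fun _ v => v a = v b) :=
  (Def.of_d0 (fun w _ => w a = w b) id Fin.elim0).congr fun _ _ _ => Subtype.ext_iff

instance Def.subset (a b : α) : Def (fun _ v => (v a : ZFSet.{u}) ⊆ (v b : ZFSet.{u})) :=
  Def.of_d0 (fun w _ => w a ⊆ w b) id Fin.elim0

instance Def.isOrdinal (a : α) : Def (fun _ v => (v a : ZFSet.{u}).IsOrdinal) :=
  Def.of_d0 (fun w _ => (w a).IsOrdinal) id Fin.elim0

instance Def.pair_mem (a b c : α) :
    Def (fun _ v => ZFSet.pair (v a : ZFSet.{u}) (v b : ZFSet.{u}) ∈ (v c : ZFSet.{u})) :=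
  Def.of_d0 (fun w _ => ZFSet.pair (w a) (w b) ∈ w c) id Fin.elim0

instance Def.eq_pair (a b c : α) :
    Def (fun _ v => (v c : ZFSet.{u}) = ZFSet.pair (v a : ZFSet.{u}) (v b : ZFSet.{u})) :=
  Def.of_d0 (fun w _ => w c = ZFSet.pair (w a) (w b)) id Fin.elim0

instance Def.upair_mem (a b c : α) :
    Def (fun _ v => ({(v a : ZFSet.{u}), (v b : ZFSet.{u})} : ZFSet.{u}) ∈ (v c : ZFSet.{u})) :=
  (Def.of_d0 (fun w _ => ∃ z ∈ w c, z = {w a, w b}) id Fin.elim0).congr fun _ _ _ => by simp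

instance Def.sUnion_mem (a b : α) :
    Def (fun _ v => ZFSet.sUnion (v a : ZFSet.{u}) ∈ (v b : ZFSet.{u})) := by
  refine (Def.of_d0 (fun w _ => ∃ z ∈ w b, (∀ x ∈ w a, ∀ y ∈ x, y ∈ z) ∧ ∀ y ∈ z, ∃ x ∈ w a, y ∈ x)
    id Fin.elim0).congr fun _ _ v => ?_
  constructor
  · intro h
    exact ⟨_, h, fun x hx y hy => ZFSet.mem_sUnion.2 ⟨x, hx, hy⟩, fun y => ZFSet.mem_sUnion.1⟩
  · rintro ⟨z, hz, h1, h2⟩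
    have e : ZFSet.sUnion (v a : ZFSet.{u}) = z := by
      ext y
      rw [ZFSet.mem_sUnion]
      exact ⟨fun ⟨x, hx, hy⟩ => h1 x hx y hy, h2 y⟩
    rwa [e]

/-- The binary relation with parameters `p` defined over `X` by `φ`. -/
def DefRel {m : ℕ} (φ : setLang.Formula (Fin m ⊕ Fin 2)) (X : Set ZFSet.{u}) (p : Fin m → X)
    (x y : X) : Prop :=
  φ.Realize (Sum.elim p ![x, y])

instance Def.defRel {m : ℕ} (φ : setLang.Formula (Fin m ⊕ Fin 2)) (g : Fin m → α) (a b : α) :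
    Def (fun (X : Set ZFSet.{u}) v => DefRel φ X (fun i => v (g i)) (v a) (v b)) := by
  refine ⟨φ.relabel (Sum.elim g ![a, b]), fun X hX v => ?_⟩
  rw [Formula.realize_relabel, DefRel]
  refine iff_of_eq (congrArg _ (funext fun i => ?_))
  rcases i with i | i
  · rfl
  · fin_cases i <;> rfl

/-- Elementary maps preserve and reflect definable predicates. -/
theorem IsElementary.def_iff {X Y : Set ZFSet.{u}} {f : X → Y} (hf : IsElementary setLang f)
    (hX : IsTransClass X) (hY : IsTransClass Y) {n : ℕ}
    (P : ∀ X : Set ZFSet.{u}, (Fin n → X) → Prop) [hP : Def P] (v : Fin n → X) :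
    P X v ↔ P Y (f ∘ v) := by
  obtain ⟨φ, hφ⟩ := hP
  rw [← hφ X hX, ← hφ Y hY, hf]

/-- `Σ₁`-elementary maps preserve and reflect `Δ₀` predicates. -/
theorem IsSigma1Elementary.d0_iff {X Y : Set ZFSet.{u}} {f : X → Y} (hf : IsSigma1Elementary f)
    (hX : IsTransClass X) (hY : IsTransClass Y) {n : ℕ}
    (P : (Fin n → ZFSet.{u}) → Prop) [hP : D0 (n := 0) (fun v _ => P v)] (v : Fin n → X) :
    P (fun i => v i) ↔ P (fun i => f (v i)) := by
  obtain ⟨φ, hφ, h⟩ := hP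
  rw [← h X hX v default, ← h Y hY (fun i => f (v i)) default]
  exact hf n φ (.of_delta0 hφ) v

end Def

/-! ### Closure properties of transitive models -/

/-- The power set of `x` in the sense of `M`. -/
noncomputable def powIn (M : Set ZFSet.{u}) (x : ZFSet.{u}) : ZFSet.{u} :=
  ZFSet.sep (· ∈ M) x.powerset

/-- `V_α` in the sense of `M`, as a set. -/
noncomputable def levelIn (M : Set ZFSet.{u}) (α : Ordinal.{u}) : ZFSet.{u} :=
  ZFSet.sep (· ∈ M) (ZFSet.vonNeumann α)

variable {M : Set ZFSet.{u}} {a b c x y z : ZFSet.{u}}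

theorem mem_powIn : y ∈ powIn M x ↔ y ⊆ x ∧ y ∈ M := by simp [powIn]

theorem mem_levelIn {α : Ordinal.{u}} : x ∈ levelIn M α ↔ x ∈ rankLevel M α := by
  simp [levelIn, rankLevel, and_comm]

namespace IsTransitiveZFModel

variable (hM : IsTransitiveZFModel M)
include hM

theorem isTransClass : IsTransClass M := hM.transitive

/-- Separation for a predicate that is definable over `M`. -/
theorem sep_def {α : Type} (P : ∀ X : Set ZFSet.{u}, (α → X) → X → Prop)
    [hP : Def (fun X (w : α ⊕ Fin 1 → X) => P X (fun a => w (Sum.inl a)) (w (Sum.inr 0)))]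
    (v : α → M) (ha : a ∈ M) :
    ZFSet.sep (fun x => ∃ h : x ∈ M, P M v ⟨x, h⟩) a ∈ M := by
  obtain ⟨φ, hφ⟩ := hP
  have hD : (Set.univ : Set M).Definable₁ setLang {x | P M v x} := by
    refine Set.definable_iff_exists_formula_sum.2
      ⟨φ.relabel (Sum.map (fun a => ⟨v a, trivial⟩) id), ?_⟩
    ext x
    simp only [Set.mem_ofPred_eq, Formula.realize_relabel]
    rw [hφ M hM.isTransClass]
    rfl
  obtain ⟨b, hb, h⟩ := hM.separation _ hD a ha
  convert hb
  ext x
  rw [ZFSet.mem_sep]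
  constructor
  · rintro ⟨hx, hxM, hp⟩
    exact (h ⟨x, hxM⟩).2 ⟨hx, hp⟩
  · intro hx
    have hxM := hM.transitive b hb x hx
    have := (h ⟨x, hxM⟩).1 hx
    exact ⟨this.1, hxM, this.2⟩

/-- Separation for `Δ₀` predicates. -/
theorem sep_mem {α : Type} (P : (α → ZFSet.{u}) → ZFSet.{u} → Prop)
    [D0 (fun v (xs : Fin 1 → ZFSet.{u}) => P v (xs 0))]
    (v : α → ZFSet.{u}) (hv : ∀ i, v i ∈ M) (ha : a ∈ M) : ZFSet.sep (P v) a ∈ M := by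
  have : Def (fun X (w : α ⊕ Fin 1 → X) => P (fun a => w (Sum.inl a)) (w (Sum.inr 0))) :=
    Def.of_d0 (fun v (xs : Fin 1 → ZFSet.{u}) => P v (xs 0)) Sum.inl Sum.inr
  have := hM.sep_def (fun X v x => P (fun a => v a) x) (fun i => ⟨v i, hv i⟩) ha
  convert this using 1
  ext x
  simp only [ZFSet.mem_sep]
  exact ⟨fun ⟨h1, h2⟩ => ⟨h1, hM.transitive _ ha _ h1, h2⟩, fun ⟨h1, _, h2⟩ => ⟨h1, h2⟩⟩

theorem singleton_mem (hx : x ∈ M) : ({x} : ZFSet.{u}) ∈ M := by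
  simpa using hM.pairing x hx x hx

theorem pair_mem (hx : x ∈ M) (hy : y ∈ M) : ZFSet.pair x y ∈ M :=
  hM.pairing _ (hM.singleton_mem hx) _ (hM.pairing _ hx _ hy)

theorem fst_mem (h : ZFSet.pair x y ∈ M) : x ∈ M :=
  hM.transitive {x} (hM.transitive _ h _ (by simp [ZFSet.pair])) _ (by simp)

theorem snd_mem (h : ZFSet.pair x y ∈ M) : y ∈ M :=
  hM.transitive {x, y} (hM.transitive _ h _ (by simp [ZFSet.pair])) _ (by simp)

theorem union_mem (hx : x ∈ M) (hy : y ∈ M) : x ∪ y ∈ M := hM.union _ (hM.pairing _ hx _ hy)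

theorem insert_mem (hx : x ∈ M) (hy : y ∈ M) : insert x y ∈ M := by
  rw [ZFSet.insert_eq]
  exact hM.union_mem (hM.singleton_mem hx) hy

theorem powIn_mem (hx : x ∈ M) : powIn M x ∈ M := by
  obtain ⟨p, hp, h⟩ := hM.powerset x hx
  convert hp
  ext y
  rw [mem_powIn]
  exact ⟨fun ⟨h1, h2⟩ => (h y h2).2 h1, fun h1 =>
    ⟨(h y (hM.transitive p hp y h1)).1 h1, hM.transitive p hp y h1⟩⟩

theorem empty_mem : ∅ ∈ M := by
  obtain ⟨w, hw, h, -⟩ := hM.infinity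
  exact hM.transitive _ hw _ h

theorem sdiff_mem (hx : x ∈ M) (hy : y ∈ M) : x \ y ∈ M := by
  have := hM.sep_mem (fun (v : Fin 1 → _) x => x ∉ v 0) ![y] (by simpa) hx
  simpa using this

theorem inter_mem (hx : x ∈ M) (hy : y ∈ M) : x ∩ y ∈ M := by
  have := hM.sep_mem (fun (v : Fin 1 → _) x => x ∈ v 0) ![y] (by simpa) hx
  simpa using this

/-- Supplies the bounding set whenever a set of pairs is obtained by separation. -/
theorem pair_mem_powIn (ha : a ∈ M) (hx : x ∈ a) (hy : y ∈ a) :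
    ZFSet.pair x y ∈ powIn M (powIn M a) := by
  have hx' := hM.transitive _ ha _ hx
  have hy' := hM.transitive _ ha _ hy
  rw [mem_powIn]
  refine ⟨fun z hz => ?_, hM.pair_mem hx' hy'⟩
  rw [ZFSet.pair, ZFSet.mem_pair] at hz
  rw [mem_powIn]
  rcases hz with rfl | rfl
  · refine ⟨fun w hw => ?_, hM.singleton_mem hx'⟩
    rw [ZFSet.mem_singleton] at hw
    exact hw ▸ hx
  · refine ⟨fun w hw => ?_, hM.pairing _ hx' _ hy'⟩
    rw [ZFSet.mem_pair] at hw
    rcases hw with rfl | rfl <;> assumption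

theorem prod_mem (ha : a ∈ M) (hb : b ∈ M) : ZFSet.prod a b ∈ M := by
  have := hM.sep_mem (fun (v : Fin 2 → _) z => ∃ x ∈ v 0, ∃ y ∈ v 1, z = ZFSet.pair x y) ![a, b]
    (by simp [Fin.forall_fin_two, ha, hb]) (hM.powIn_mem (hM.powIn_mem (hM.union_mem ha hb)))
  convert this
  ext z
  rw [ZFSet.mem_prod, ZFSet.mem_sep]
  simp only [Matrix.cons_val_zero, Matrix.cons_val_one]
  refine ⟨fun h => ⟨?_, h⟩, fun h => h.2⟩
  obtain ⟨x, hx, y, hy, rfl⟩ := h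
  exact hM.pair_mem_powIn (hM.union_mem ha hb) (by simp [hx]) (by simp [hy])

end IsTransitiveZFModel

/-! ### The cumulative hierarchy inside `M`. -/

theorem mem_rankLevel_iff {α : Ordinal.{u}} (hM : IsTransitiveZFModel M) (hx : x ∈ M) :
    x ∈ rankLevel M α ↔ ∃ ζ < α, x ⊆ levelIn M ζ := by
  simp only [rankLevel, Set.mem_ofPred_eq, hx, true_and, ZFSet.mem_vonNeumann']
  refine exists_congr fun ζ => and_congr_right fun _ => ⟨fun h z hz => ?_, fun h z hz => ?_⟩
  · exact mem_levelIn.2 ⟨hM.transitive _ hx _ hz, h hz⟩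
  · exact (mem_levelIn.1 (h hz)).2

/-- In `X`, `g` is the function `ζ ↦ V_ζ` with domain `γ`. -/
def IsHierarchy (X : Set ZFSet.{u}) (g γ : X) : Prop :=
  (∀ z : X, (z : ZFSet.{u}) ∈ (g : ZFSet.{u}) → ∃ ζ u : X, (ζ : ZFSet.{u}) ∈ (γ : ZFSet.{u}) ∧
    (z : ZFSet.{u}) = ZFSet.pair ζ u ∧
    ∀ x : X, (x : ZFSet.{u}) ∈ (u : ZFSet.{u}) ↔ ∃ ζ' u' : X, (ζ' : ZFSet.{u}) ∈ (ζ : ZFSet.{u}) ∧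
      ZFSet.pair ζ' u' ∈ (g : ZFSet.{u}) ∧ (x : ZFSet.{u}) ⊆ (u' : ZFSet.{u})) ∧
  ∀ ζ : X, (ζ : ZFSet.{u}) ∈ (γ : ZFSet.{u}) → ∃ u : X, ZFSet.pair ζ u ∈ (g : ZFSet.{u})

/-- In `X`, `z` is the pair `(γ, V_γ)`. -/
def IsLevelPair (X : Set ZFSet.{u}) (γ z : X) : Prop :=
  ∃ g y : X, IsHierarchy X g γ ∧ (z : ZFSet.{u}) = ZFSet.pair γ y ∧
    ∀ x : X, (x : ZFSet.{u}) ∈ (y : ZFSet.{u}) ↔ ∃ ζ u : X, (ζ : ZFSet.{u}) ∈ (γ : ZFSet.{u}) ∧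
      ZFSet.pair ζ u ∈ (g : ZFSet.{u}) ∧ (x : ZFSet.{u}) ⊆ (u : ZFSet.{u})

instance {α : Type} (a b : α) :
    Def (fun (X : Set ZFSet.{u}) (v : α → X) => IsHierarchy X (v a) (v b)) := by
  unfold IsHierarchy
  infer_instance

instance {α : Type} (a b : α) :
    Def (fun (X : Set ZFSet.{u}) (v : α → X) => IsLevelPair X (v a) (v b)) := by
  unfold IsLevelPair
  infer_instance

/-- `g` is the set of the pairs `(ζ, V_ζ)` for `ζ < γ`. -/
def IsHierarchySet (M : Set ZFSet.{u}) (γ : Ordinal.{u}) (g : ZFSet.{u}) : Prop :=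
  ∀ z, z ∈ g ↔ ∃ ζ < γ, z = ZFSet.pair ζ.toZFSet (levelIn M ζ)

section Hierarchy

variable (hM : IsTransitiveZFModel M) {γ ζ : Ordinal.{u}} {g : ZFSet.{u}}
include hM

theorem IsHierarchySet.mem_level (h : IsHierarchySet M γ g) (hg : g ∈ M) (hx : x ∈ M) :
    x ∈ levelIn M γ ↔ ∃ ζ u : M, (ζ : ZFSet.{u}) ∈ γ.toZFSet ∧
      ZFSet.pair ζ u ∈ g ∧ x ⊆ (u : ZFSet.{u}) := by
  rw [mem_levelIn, mem_rankLevel_iff hM hx]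
  constructor
  · rintro ⟨ζ, hζ, hxζ⟩
    have h1 : ZFSet.pair ζ.toZFSet (levelIn M ζ) ∈ g := (h _).2 ⟨ζ, hζ, rfl⟩
    have h2 := hM.transitive _ hg _ h1
    exact ⟨⟨_, hM.fst_mem h2⟩, ⟨_, hM.snd_mem h2⟩, Ordinal.toZFSet_mem_toZFSet_iff.2 hζ, h1, hxζ⟩
  · rintro ⟨ζ, u, hζ, hu, hxu⟩
    obtain ⟨ζ', hζ', e⟩ := (h _).1 hu
    obtain ⟨-, e⟩ := ZFSet.pair_inj.1 e
    exact ⟨ζ', hζ', e ▸ hxu⟩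

theorem IsHierarchySet.level_mem (h : IsHierarchySet M γ g) (hg : g ∈ M) (hγ : γ.toZFSet ∈ M) :
    levelIn M γ ∈ M := by
  -- A member of `V_γ` is a subset of some `V_ζ` occurring in `g`. As `V_ζ ∈ {ζ, V_ζ} ∈ (ζ, V_ζ) ∈
  -- g`, it is a subset of the threefold union of `g`.
  have := hM.sep_def (fun X (v : Fin 2 → X) x => ∃ ζ u : X, (ζ : ZFSet.{u}) ∈ (v 0 : ZFSet.{u}) ∧
      ZFSet.pair ζ u ∈ (v 1 : ZFSet.{u}) ∧ (x : ZFSet.{u}) ⊆ (u : ZFSet.{u}))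
      ![⟨_, hγ⟩, ⟨_, hg⟩] (hM.powIn_mem (hM.union _ (hM.union _ (hM.union _ hg))))
  convert this
  ext x
  rw [ZFSet.mem_sep, mem_powIn]
  constructor
  · intro hx
    have hxM : x ∈ M := (mem_levelIn.1 hx).1
    have hx' := (h.mem_level hM hg hxM).1 hx
    refine ⟨⟨?_, hxM⟩, hxM, hx'⟩
    obtain ⟨ζ, u, -, h1, h2⟩ := hx'
    intro y hy
    simp only [ZFSet.mem_sUnion]
    exact ⟨u, ⟨_, ⟨_, h1, by simp [ZFSet.pair]; exact Or.inr rfl⟩, by simp⟩, h2 hy⟩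
  · rintro ⟨⟨-, hxM⟩, _, hx⟩
    exact (h.mem_level hM hg hxM).2 hx

theorem IsHierarchySet.mono (h : IsHierarchySet M γ g) (hg : g ∈ M) (hγ : γ.toZFSet ∈ M)
    (hζ : ζ ≤ γ) : ∃ g' ∈ M, IsHierarchySet M ζ g' := by
  have hζ' : ζ.toZFSet ∈ M := by
    rcases hζ.eq_or_lt with rfl | h
    · exact hγ
    · exact hM.transitive _ hγ _ (Ordinal.toZFSet_mem_toZFSet_iff.2 h)
  refine ⟨_, hM.sep_def (fun X (v : Fin 1 → X) z => ∃ ξ u : X, (ξ : ZFSet.{u}) ∈ (v 0 : ZFSet.{u}) ∧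
    (z : ZFSet.{u}) = ZFSet.pair ξ u) ![⟨_, hζ'⟩] hg, fun z => ?_⟩
  rw [ZFSet.mem_sep]
  constructor
  · rintro ⟨hz, -, ⟨ξ, hξM⟩, u, hξ, hzu : z = ZFSet.pair ξ u⟩
    obtain ⟨ξ', -, rfl⟩ := (h z).1 hz
    obtain ⟨e, -⟩ := ZFSet.pair_inj.1 hzu
    change ξ ∈ ζ.toZFSet at hξ
    rw [← e, Ordinal.toZFSet_mem_toZFSet_iff] at hξ
    exact ⟨ξ', hξ, rfl⟩
  · rintro ⟨ξ, hξ, rfl⟩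
    have h1 := (h _).2 ⟨ξ, hξ.trans_le hζ, rfl⟩
    have h2 := hM.transitive _ hg _ h1
    exact ⟨h1, h2, ⟨_, hM.fst_mem h2⟩, ⟨_, hM.snd_mem h2⟩, Ordinal.toZFSet_mem_toZFSet_iff.2 hξ, rfl⟩

/-- Existence half of the definability of `γ ↦ (γ, V_γ)` over `M`: a true hierarchy meets the
recursive description, because its restrictions to smaller ordinals are again hierarchies in `M`. -/
theorem IsHierarchySet.isLevelPair (h : IsHierarchySet M γ g) (hg : g ∈ M) (hγ : γ.toZFSet ∈ M)
    (hz : z ∈ M) (e : z = ZFSet.pair γ.toZFSet (levelIn M γ)) :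
    IsLevelPair M ⟨γ.toZFSet, hγ⟩ ⟨z, hz⟩ := by
  refine ⟨⟨g, hg⟩, ⟨_, h.level_mem hM hg hγ⟩, ⟨fun z hz => ?_, fun ξ hξ => ?_⟩, e,
    fun x => h.mem_level hM hg x.2⟩
  · obtain ⟨ξ, hξ, e⟩ := (h z).1 hz
    have hξM : ξ.toZFSet ∈ M := hM.transitive _ hγ _ (Ordinal.toZFSet_mem_toZFSet_iff.2 hξ)
    obtain ⟨g', hg', h'⟩ := h.mono hM hg hγ hξ.le
    refine ⟨⟨_, hξM⟩, ⟨_, h'.level_mem hM hg' hξM⟩, Ordinal.toZFSet_mem_toZFSet_iff.2 hξ, e,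
      fun x => (h'.mem_level hM hg' x.2).trans ?_⟩
    refine exists₂_congr fun ζ u => and_congr_right fun hζ => and_congr_left fun _ => ?_
    rw [h', h]
    refine exists_congr fun ζ' => and_congr_left fun e' => ?_
    obtain ⟨e1, -⟩ := ZFSet.pair_inj.1 e'
    rw [e1] at hζ
    have := Ordinal.toZFSet_mem_toZFSet_iff.1 hζ
    exact ⟨fun _ => this.trans hξ, fun _ => this⟩
  · obtain ⟨ξ', hξ', e⟩ := Ordinal.mem_toZFSet_iff.1 (show (ξ : ZFSet.{u}) ∈ γ.toZFSet from hξ)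
    obtain ⟨g', hg', h'⟩ := h.mono hM hg hγ hξ'.le
    exact ⟨⟨_, h'.level_mem hM hg' (e ▸ ξ.2)⟩, (h _).2 ⟨ξ', hξ', congrArg (ZFSet.pair · _) e.symm⟩⟩

/-- Uniqueness half: by induction on `ζ < γ`, every entry of a set meeting the recursive description
is the true `V_ζ`. -/
theorem IsLevelPair.eq_pair (hγ : γ.toZFSet ∈ M) {z : M} (h : IsLevelPair M ⟨γ.toZFSet, hγ⟩ z) :
    (z : ZFSet.{u}) = ZFSet.pair γ.toZFSet (levelIn M γ) := by
  obtain ⟨g, y, ⟨h1, h2⟩, h3, h4⟩ := h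
  have key : ∀ ζ : Ordinal.{u}, ∀ u : M, ζ < γ → ZFSet.pair ζ.toZFSet u ∈ (g : ZFSet.{u}) →
      (u : ZFSet.{u}) = levelIn M ζ := by
    intro ζ
    induction ζ using WellFoundedLT.induction with
    | ind ζ ih =>
    intro u hζ hu
    obtain ⟨⟨ζ', hζM⟩, u', -, e, h5⟩ := h1 ⟨_, hM.transitive _ g.2 _ hu⟩ hu
    obtain ⟨e1, e2⟩ := ZFSet.pair_inj.1 e
    have e2 := Subtype.ext e2
    change ζ.toZFSet = ζ' at e1
    subst e1 e2
    ext x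
    have h7 : x ∈ (u : ZFSet.{u}) → x ∈ M := fun hx => hM.transitive _ u.2 _ hx
    have h8 : x ∈ levelIn M ζ → x ∈ M := fun hx => (mem_levelIn.1 hx).1
    suffices ∀ hx : x ∈ M, x ∈ (u : ZFSet.{u}) ↔ x ∈ levelIn M ζ from
      ⟨fun hx => (this (h7 hx)).1 hx, fun hx => (this (h8 hx)).2 hx⟩
    intro hx
    rw [h5 ⟨x, hx⟩, mem_levelIn, mem_rankLevel_iff hM hx]
    constructor
    · rintro ⟨⟨ξ, hξM⟩, w, hξ, hw, hxw⟩
      obtain ⟨ξ, hξ', rfl⟩ := Ordinal.mem_toZFSet_iff.1 (show ξ ∈ ζ.toZFSet from hξ)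
      exact ⟨ξ, hξ', ih ξ hξ' w (hξ'.trans hζ) hw ▸ hxw⟩
    · rintro ⟨ξ, hξ, hxξ⟩
      have hξM : ξ.toZFSet ∈ M := hM.transitive _ hζM _ (Ordinal.toZFSet_mem_toZFSet_iff.2 hξ)
      obtain ⟨w, hw⟩ := h2 ⟨_, hξM⟩ (Ordinal.toZFSet_mem_toZFSet_iff.2 (hξ.trans hζ))
      refine ⟨⟨_, hξM⟩, w, Ordinal.toZFSet_mem_toZFSet_iff.2 hξ, hw, ?_⟩
      rw [ih ξ hξ w (hξ.trans hζ) hw]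
      exact hxξ
  rw [h3]
  congr 1
  ext x
  suffices ∀ hx : x ∈ M, x ∈ (y : ZFSet.{u}) ↔ x ∈ levelIn M γ from
    ⟨fun hx => (this (hM.transitive _ y.2 _ hx)).1 hx, fun hx => (this (mem_levelIn.1 hx).1).2 hx⟩
  intro hx
  rw [h4 ⟨x, hx⟩, mem_levelIn, mem_rankLevel_iff hM hx]
  constructor
  · rintro ⟨⟨ξ, hξM⟩, w, hξ, hw, hxw⟩
    obtain ⟨ξ, hξ', rfl⟩ := Ordinal.mem_toZFSet_iff.1 (show ξ ∈ γ.toZFSet from hξ)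
    exact ⟨ξ, hξ', key ξ w hξ' hw ▸ hxw⟩
  · rintro ⟨ξ, hξ, hxξ⟩
    have hξM : ξ.toZFSet ∈ M := hM.transitive _ hγ _ (Ordinal.toZFSet_mem_toZFSet_iff.2 hξ)
    obtain ⟨w, hw⟩ := h2 ⟨_, hξM⟩ (Ordinal.toZFSet_mem_toZFSet_iff.2 hξ)
    refine ⟨⟨_, hξM⟩, w, Ordinal.toZFSet_mem_toZFSet_iff.2 hξ, hw, ?_⟩
    rw [key ξ w hξ hw]
    exact hxξ

theorem exists_isHierarchySet (γ : Ordinal.{u}) (hγ : γ.toZFSet ∈ M) :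
    ∃ g ∈ M, IsHierarchySet M γ g := by
  induction γ using WellFoundedLT.induction with
  | ind γ ih =>
  have hmem : ∀ ζ < γ, ζ.toZFSet ∈ M := fun ζ hζ =>
    hM.transitive _ hγ _ (Ordinal.toZFSet_mem_toZFSet_iff.2 hζ)
  have hex : ∀ ζ (hζ : ζ < γ), ∃ z : M, IsLevelPair M ⟨_, hmem ζ hζ⟩ z := by
    intro ζ hζ
    obtain ⟨g, hg, h⟩ := ih ζ hζ (hmem ζ hζ)
    exact ⟨⟨_, hM.pair_mem (hmem ζ hζ) (h.level_mem hM hg (hmem ζ hζ))⟩,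
      h.isLevelPair hM hg _ _ rfl⟩
  have hDef : (Set.univ : Set M).Definable₂ setLang {p | IsLevelPair M p.1 p.2} := by
    obtain ⟨φ, hφ⟩ := (inferInstance :
      Def (fun (X : Set ZFSet.{u}) (v : Fin 2 → X) => IsLevelPair X (v 0) (v 1)))
    refine Set.definable_iff_exists_formula_sum.2 ⟨φ.relabel Sum.inr, ?_⟩
    ext x
    simp only [Set.mem_ofPred_eq, Formula.realize_relabel]
    rw [hφ M hM.isTransClass]
    rfl
  -- Collection only gives a set containing the required pairs; separation by the same definable
  -- relation then trims it to the hierarchy.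
  obtain ⟨b, hb, h⟩ := hM.collection _ hDef _ hγ (by
    rintro ⟨x, hxM⟩ hx
    obtain ⟨ζ, hζ, rfl⟩ := Ordinal.mem_toZFSet_iff.1 (show x ∈ γ.toZFSet from hx)
    exact hex ζ hζ)
  refine ⟨_, hM.sep_def (fun X (v : Fin 1 → X) z => ∃ ζ : X, (ζ : ZFSet.{u}) ∈ (v 0 : ZFSet.{u}) ∧
    IsLevelPair X ζ z) ![⟨_, hγ⟩] hb, fun z => ?_⟩
  rw [ZFSet.mem_sep]
  constructor
  · rintro ⟨hz, hzM, ⟨ζ, hζM⟩, hζ, hz⟩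
    obtain ⟨ζ, hζγ, rfl⟩ := Ordinal.mem_toZFSet_iff.1 (show ζ ∈ γ.toZFSet from hζ)
    exact ⟨ζ, hζγ, hz.eq_pair hM⟩
  · rintro ⟨ζ, hζ, rfl⟩
    obtain ⟨y, hy, hyz⟩ := h ⟨_, hmem ζ hζ⟩ (Ordinal.toZFSet_mem_toZFSet_iff.2 hζ)
    have := IsLevelPair.eq_pair hM _ hyz
    rw [← this]
    exact ⟨hy, y.2, ⟨_, hmem ζ hζ⟩, Ordinal.toZFSet_mem_toZFSet_iff.2 hζ, hyz⟩

theorem levelIn_mem (hγ : γ.toZFSet ∈ M) : levelIn M γ ∈ M := by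
  obtain ⟨g, hg, h⟩ := exists_isHierarchySet hM γ hγ
  exact h.level_mem hM hg hγ

end Hierarchy

/-! ### Coding finite tuples by sets -/

/-- The set `{(c 0, xs 0), …, (c (n - 1), xs (n - 1))}` that codes the tuple `xs`. -/
noncomputable def tup (c : ℕ → ZFSet.{u}) {n : ℕ} (xs : Fin n → ZFSet.{u}) : ZFSet.{u} :=
  ZFSet.range (fun i : Fin n => ZFSet.pair (c i) (xs i))

section tup

variable {c : ℕ → ZFSet.{u}} {n : ℕ}

theorem mem_tup {xs : Fin n → ZFSet.{u}} {z : ZFSet.{u}} :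
    z ∈ tup c xs ↔ ∃ i : Fin n, z = ZFSet.pair (c i) (xs i) := by
  simp [tup, eq_comm]

theorem pair_mem_tup (hc : Function.Injective c) {xs : Fin n → ZFSet.{u}} {i : Fin n}
    {y : ZFSet.{u}} : ZFSet.pair (c i) y ∈ tup c xs ↔ y = xs i := by
  rw [mem_tup]
  constructor
  · rintro ⟨k, hk⟩
    obtain ⟨h1, h2⟩ := ZFSet.pair_inj.1 hk
    rw [h2, Fin.ext (hc h1)]
  · rintro rfl
    exact ⟨i, rfl⟩

theorem tup_injective (hc : Function.Injective c) {xs ys : Fin n → ZFSet.{u}}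
    (h : tup c xs = tup c ys) : xs = ys := by
  funext i
  rw [← pair_mem_tup hc, ← h, pair_mem_tup hc]

theorem tup_succ (xs : Fin (n + 1) → ZFSet.{u}) :
    tup c xs = insert (ZFSet.pair (c n) (xs (Fin.last n))) (tup c (fun i => xs i.castSucc)) := by
  ext z
  simp only [mem_tup, ZFSet.mem_insert_iff]
  constructor
  · rintro ⟨i, rfl⟩
    induction i using Fin.lastCases with
    | last => exact Or.inl (by simp)
    | cast i => exact Or.inr ⟨i, by simp⟩
  · rintro (rfl | ⟨i, rfl⟩)
    · exact ⟨Fin.last n, by simp⟩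
    · exact ⟨i.castSucc, by simp⟩

theorem tup_snoc {X : Set ZFSet.{u}} (xs : Fin n → X) (y : X) :
    tup c (fun i => ((Fin.snoc xs y : Fin (n + 1) → X) i : ZFSet.{u})) =
      insert (ZFSet.pair (c n) y) (tup c (fun i => xs i)) := by
  rw [tup_succ]
  simp

@[simp] theorem tup_zero (xs : Fin 0 → ZFSet.{u}) : tup c xs = ∅ := by
  ext z
  simp [mem_tup]

end tup

/-! ### Sets of codes of relations, and truth sets of formulas -/

/-- The set of the codes of the tuples that satisfy `R` exists in `M`. -/
def IsCoded (M : Set ZFSet.{u}) (c : ℕ → ZFSet.{u}) {X : Set ZFSet.{u}} {n : ℕ}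
    (R : (Fin n → X) → Prop) : Prop :=
  ∃ S ∈ M, ∀ t, t ∈ S ↔ ∃ xs : Fin n → X, t = tup c (fun i => xs i) ∧ R xs

section IsCoded

variable {M : Set ZFSet.{u}} (hM : IsTransitiveZFModel M) {c : ℕ → ZFSet.{u}}
  (hcM : ∀ n, c n ∈ M) (hc : Function.Injective c) {X : Set ZFSet.{u}} {E : ZFSet.{u}}
  (hE : E ∈ M) (hEX : ∀ x, x ∈ E ↔ x ∈ X) {n : ℕ} {R R' : (Fin n → X) → Prop}

include hM

include hcM hE hEX in
-- With `T` the set of codes of `n`-tuples, a code of an `(n + 1)`-tuple is a subset of `⋃ T ∪ {c n}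
-- × E`, and the power set of that bounds the separation.
theorem isCoded_true (n : ℕ) : IsCoded M c (fun _ : Fin n → X => True) := by
  induction n with
  | zero =>
    refine ⟨{∅}, hM.singleton_mem hM.empty_mem, fun t => ?_⟩
    simp only [tup_zero, ZFSet.mem_singleton, and_true]
    exact ⟨fun h => ⟨Fin.elim0, h⟩, fun ⟨_, h⟩ => h⟩
  | succ n ih =>
    obtain ⟨T, hT, h⟩ := ih
    refine ⟨_, hM.sep_mem (fun (v : Fin 3 → _) t => ∃ s ∈ v 0, ∃ y ∈ v 1,
      t = insert (ZFSet.pair (v 2) y) s) ![T, E, c n] ?_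
      (hM.powIn_mem (hM.union_mem (hM.union _ hT) (hM.prod_mem (hM.singleton_mem (hcM n)) hE))),
      fun t => ?_⟩
    · simp [Fin.forall_fin_succ, hT, hE, hcM]
    · simp only [ZFSet.mem_sep, mem_powIn, and_true]
      constructor
      · rintro ⟨-, s, hs, y, hy, rfl⟩
        obtain ⟨xs, rfl, -⟩ := (h s).1 hs
        exact ⟨Fin.snoc xs ⟨y, (hEX y).1 hy⟩, (tup_snoc xs ⟨y, (hEX y).1 hy⟩).symm⟩
      · rintro ⟨xs, rfl⟩
        rw [tup_succ]
        have h1 := (h _).2 ⟨fun i => xs i.castSucc, rfl, trivial⟩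
        have h2 := (hEX _).2 (xs (Fin.last n)).2
        refine ⟨⟨fun z hz => ?_, hM.insert_mem (hM.pair_mem (hcM n) (hM.transitive _ hE _ h2))
          (hM.transitive _ hT _ h1)⟩, _, h1, _, h2, rfl⟩
        rw [ZFSet.mem_insert_iff] at hz
        rw [ZFSet.mem_union, ZFSet.mem_sUnion, ZFSet.mem_prod]
        rcases hz with rfl | hz
        · exact Or.inr ⟨_, by simp, _, h2, rfl⟩
        · exact Or.inl ⟨_, h1, hz⟩

omit hM in
theorem IsCoded.congr (h : IsCoded M c R) (hR : ∀ xs, R' xs ↔ R xs) : IsCoded M c R' := by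
  rwa [show R' = R from funext fun xs => propext (hR xs)]

include hc

omit hM in
theorem IsCoded.spec {S : ZFSet.{u}}
    (h : ∀ t, t ∈ S ↔ ∃ xs : Fin n → X, t = tup c (fun i => xs i) ∧ R xs) (xs : Fin n → X) :
    tup c (fun i => (xs i : ZFSet.{u})) ∈ S ↔ R xs := by
  rw [h]
  refine ⟨fun ⟨ys, e, hy⟩ => ?_, fun h => ⟨xs, rfl, h⟩⟩
  have := tup_injective hc e
  rwa [show xs = ys from funext fun i => Subtype.ext (congrFun this i)]

omit hc in
include hcM hE hEX in
/-- Relations given by a `Δ₀` property of the codes are coded. -/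
theorem isCoded_of_d0 {α : Type} (P : (α → ZFSet.{u}) → ZFSet.{u} → Prop)
    [D0 (fun v (xs : Fin 1 → ZFSet.{u}) => P v (xs 0))] (v : α → ZFSet.{u}) (hv : ∀ i, v i ∈ M)
    (h : ∀ xs : Fin n → X, P v (tup c (fun i => xs i)) ↔ R xs) : IsCoded M c R := by
  obtain ⟨T, hT, h'⟩ := isCoded_true hM hcM hE hEX n
  refine ⟨_, hM.sep_mem P v hv hT, fun t => ?_⟩
  rw [ZFSet.mem_sep, h']
  constructor
  · rintro ⟨⟨xs, rfl, -⟩, h1⟩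
    exact ⟨xs, rfl, (h xs).1 h1⟩
  · rintro ⟨xs, rfl, h1⟩
    exact ⟨⟨xs, rfl, trivial⟩, (h xs).2 h1⟩

include hcM hE hEX

theorem IsCoded.not (h : IsCoded M c R) : IsCoded M c (fun xs => ¬ R xs) := by
  obtain ⟨S, hS, h⟩ := h
  exact isCoded_of_d0 hM hcM hE hEX (fun (v : Fin 1 → _) t => t ∉ v 0) ![S] (by simpa)
    fun xs => not_congr (IsCoded.spec hc h xs)

theorem IsCoded.imp (h : IsCoded M c R) (h' : IsCoded M c R') :
    IsCoded M c (fun xs => R xs → R' xs) := by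
  obtain ⟨S, hS, h⟩ := h
  obtain ⟨S', hS', h'⟩ := h'
  exact isCoded_of_d0 hM hcM hE hEX (fun (v : Fin 2 → _) t => t ∈ v 0 → t ∈ v 1) ![S, S']
    (by simp [Fin.forall_fin_two, hS, hS'])
    fun xs => imp_congr (IsCoded.spec hc h xs) (IsCoded.spec hc h' xs)

/-- The quantifier over `X` is bounded by the set `E`, so the truth set is separated by a `Δ₀`
condition with `E` as a parameter. -/
theorem IsCoded.all {R : (Fin (n + 1) → X) → Prop} (h : IsCoded M c R) :
    IsCoded M c (fun xs : Fin n → X => ∀ y : X, R (Fin.snoc xs y)) := by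
  obtain ⟨S, hS, h⟩ := h
  refine isCoded_of_d0 hM hcM hE hEX (fun (v : Fin 3 → _) t => ∀ y ∈ v 1, ∃ s ∈ v 0,
    s = insert (ZFSet.pair (v 2) y) t) ![S, E, c n] (by simp [Fin.forall_fin_succ, hS, hE, hcM])
    fun xs => ?_
  change (∀ y ∈ E, ∃ s ∈ S, s = insert (ZFSet.pair (c n) y) _) ↔ _
  simp only [exists_eq_right]
  constructor
  · intro H y
    rw [← IsCoded.spec hc h, tup_snoc]
    exact H y ((hEX y).2 y.2)
  · intro H y hy
    have := H ⟨y, (hEX y).1 hy⟩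
    rwa [← IsCoded.spec hc h, tup_snoc] at this

theorem isCoded_mem (i k : Fin n) :
    IsCoded M c (fun xs : Fin n → X => (xs i : ZFSet.{u}) ∈ (xs k : ZFSet.{u})) := by
  refine isCoded_of_d0 hM hcM hE hEX (fun (v : Fin 3 → _) t => ∃ x ∈ v 0, ∃ y ∈ v 0,
    ZFSet.pair (v 1) x ∈ t ∧ ZFSet.pair (v 2) y ∈ t ∧ x ∈ y) ![E, c i, c k]
    (by simp [Fin.forall_fin_succ, hE, hcM]) fun xs => ?_
  simp only [Matrix.cons_val, pair_mem_tup hc]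
  constructor
  · rintro ⟨_, -, _, -, rfl, rfl, h⟩
    exact h
  · exact fun h => ⟨_, (hEX _).2 (xs i).2, _, (hEX _).2 (xs k).2, rfl, rfl, h⟩

theorem isCoded_eq (i k : Fin n) : IsCoded M c (fun xs : Fin n → X => xs i = xs k) := by
  refine isCoded_of_d0 hM hcM hE hEX (fun (v : Fin 3 → _) t => ∃ x ∈ v 0,
    ZFSet.pair (v 1) x ∈ t ∧ ZFSet.pair (v 2) x ∈ t) ![E, c i, c k]
    (by simp [Fin.forall_fin_succ, hE, hcM]) fun xs => ?_
  simp only [Matrix.cons_val, pair_mem_tup hc]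
  constructor
  · rintro ⟨_, -, rfl, h⟩
    exact Subtype.ext h
  · exact fun h => ⟨_, (hEX _).2 (xs i).2, rfl, congrArg _ h⟩

theorem isCoded_pred {A : ZFSet.{u}} (hA : A ∈ M) (i : Fin n) :
    IsCoded M c (fun xs : Fin n → X => (xs i : ZFSet.{u}) ∈ A) := by
  refine isCoded_of_d0 hM hcM hE hEX (fun (v : Fin 2 → _) t => ∃ x ∈ v 0,
    ZFSet.pair (v 1) x ∈ t) ![A, c i]
    (by simp [Fin.forall_fin_succ, hA, hcM]) fun xs => ?_
  simp only [Matrix.cons_val, pair_mem_tup hc]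
  simp

end IsCoded

/-- Satisfaction in `(X, ∈, A)`. -/
def PredRealize (X A : Set ZFSet.{u}) {n : ℕ} (φ : setPredLang.BoundedFormula Empty n)
    (xs : Fin n → X) : Prop :=
  @BoundedFormula.Realize setPredLang X (predStructure X A) Empty n φ default xs

/-- Induction on formulas of the language of set theory with a predicate, without free variables
other than the numbered ones. -/
theorem predFormula_induction {C : ∀ {n : ℕ}, setPredLang.BoundedFormula Empty n → Prop}
    (falsum : ∀ n, C (BoundedFormula.falsum (n := n)))
    (equal : ∀ (n) (i k : Fin n), C (.equal (.var (Sum.inr i)) (.var (Sum.inr k))))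
    (mem : ∀ (n) (i k : Fin n), C (.rel (SetPredRel.mem : setPredLang.Relations 2)
      ![.var (Sum.inr i), .var (Sum.inr k)]))
    (pred : ∀ (n) (i : Fin n), C (.rel (SetPredRel.pred : setPredLang.Relations 1)
      ![.var (Sum.inr i)]))
    (imp : ∀ (n) (φ ψ : setPredLang.BoundedFormula Empty n), C φ → C ψ → C (φ.imp ψ))
    (all : ∀ (n) (φ : setPredLang.BoundedFormula Empty (n + 1)), C φ → C φ.all) :
    ∀ {n : ℕ} (φ : setPredLang.BoundedFormula Empty n), C φ := by
  have hterm : ∀ {n : ℕ} (t : setPredLang.Term (Empty ⊕ Fin n)), ∃ i, t = .var (Sum.inr i) := by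
    intro n t
    rcases t with (a | i) | f
    · exact a.elim
    · exact ⟨i, rfl⟩
    · exact nomatch f
  intro n φ
  induction φ with
  | falsum => exact falsum _
  | equal s t =>
    obtain ⟨i, rfl⟩ := hterm s
    obtain ⟨k, rfl⟩ := hterm t
    exact equal _ i k
  | rel R ts =>
    cases R with
    | mem =>
      obtain ⟨i, hi⟩ := hterm (ts 0)
      obtain ⟨k, hk⟩ := hterm (ts 1)
      have : ts = ![.var (Sum.inr i), .var (Sum.inr k)] := by
        funext l
        fin_cases l
        · exact hi
        · exact hk
      rw [this]
      exact mem _ i k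
    | pred =>
      obtain ⟨i, hi⟩ := hterm (ts 0)
      have : ts = ![.var (Sum.inr i)] := by
        funext l
        fin_cases l
        exact hi
      rw [this]
      exact pred _ i
  | imp φ ψ h1 h2 => exact imp _ _ _ h1 h2
  | all φ h => exact all _ _ h

section PredRealize

variable {X A : Set ZFSet.{u}} {n : ℕ} {xs : Fin n → X}

theorem predRealize_falsum : PredRealize X A (BoundedFormula.falsum (n := n)) xs ↔ False := Iff.rfl

/-- Elementarity is about formulas whose free variables are among the numbered ones. -/
theorem isPredElementary_iff {Y B : Set ZFSet.{u}} {f : X → Y} :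
    IsPredElementary A B f ↔ ∀ (n : ℕ) (φ : setPredLang.BoundedFormula Empty n) (xs : Fin n → X),
      PredRealize X A φ xs ↔ PredRealize Y B φ (f ∘ xs) := by
  constructor
  · intro h n φ xs
    have := @h n (φ.toFormula.relabel (Sum.elim Empty.elim id)) xs
    simp only [Formula.realize_relabel, BoundedFormula.realize_toFormula] at this
    rw [Subsingleton.elim ((xs ∘ _) ∘ Sum.inl) default,
      Subsingleton.elim (((f ∘ xs) ∘ _) ∘ Sum.inl) default] at this
    exact this
  · intro h n φ xs
    have h' := h n (BoundedFormula.relabel Sum.inr φ) xs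
    unfold PredRealize at h'
    let := predStructure X A
    let := predStructure Y B
    rwa [Formula.realize_relabel_sumInr, Formula.realize_relabel_sumInr] at h'

/-- The inclusion of the language of set theory. -/
def setLangHom : setLang →ᴸ setPredLang where
  onFunction := fun _ f => nomatch f
  onRelation := fun _ R => match R with
    | SetRel.mem => SetPredRel.mem

theorem isExpansionOn_predStructure (X A : Set ZFSet.{u}) :
    letI := predStructure X A
    setLangHom.IsExpansionOn X := by
  let := predStructure X A
  refine { map_onFunction := fun f => (nomatch f), map_onRelation := fun R x => ?_ }
  cases R
  rfl

theorem realize_onFormula_predStructure (φ : setLang.Formula (Fin n)) :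
    @Formula.Realize setPredLang X (predStructure X A) _ (setLangHom.onFormula φ) xs ↔
      φ.Realize xs := by
  let := predStructure X A
  have := isExpansionOn_predStructure X A
  exact LHom.realize_onFormula setLangHom φ

theorem IsPredElementary.isElementary {Y B : Set ZFSet.{u}} {f : X → Y}
    (h : IsPredElementary A B f) : IsElementary setLang f := by
  intro n φ x
  rw [← realize_onFormula_predStructure (A := A), ← realize_onFormula_predStructure (A := B)]
  exact h n _ x

end PredRealize

/-! ### Truth sets and definable subsets of a set structure in `M`. -/

section truth

variable {M : Set ZFSet.{u}} (hM : IsTransitiveZFModel M) {X : Set ZFSet.{u}} {E A : ZFSet.{u}}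
  (hE : E ∈ M) (hEX : ∀ x, x ∈ E ↔ x ∈ X) (hA : A ∈ M)
include hM hE hEX

include hA in
/-- The truth set in `(X, ∈, A)` of a formula lies in `M`. -/
theorem isCoded_predRealize {c : ℕ → ZFSet.{u}} (hcM : ∀ n, c n ∈ M) (hc : Function.Injective c)
    {n : ℕ} (φ : setPredLang.BoundedFormula Empty n) :
    IsCoded M c (PredRealize X {x | x ∈ A} φ) := by
  induction φ using predFormula_induction with
  | falsum n =>
    exact ((isCoded_true hM hcM hE hEX n).not hM hcM hc hE hEX).congr fun _ => by
      simp [predRealize_falsum]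
  | equal n i k => exact isCoded_eq hM hcM hc hE hEX i k
  | mem n i k => exact isCoded_mem hM hcM hc hE hEX i k
  | pred n i => exact isCoded_pred hM hcM hc hE hEX hA i
  | imp n φ ψ h h' => exact h.imp hM hcM hc hE hEX h'
  | all n φ h => exact h.all hM hcM hc hE hEX

/-- Distinct tags for the entries of a tuple. -/
noncomputable def tag : ℕ → ZFSet.{u}
  | 0 => ∅
  | n + 1 => {tag n}

omit hM hE hEX in
theorem tag_injective : Function.Injective tag.{u} := by
  have h0 : ∀ n, tag.{u} (n + 1) ≠ tag 0 := by
    intro n e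
    have h : tag n ∈ tag (n + 1) := ZFSet.mem_singleton.2 rfl
    rw [e] at h
    exact ZFSet.notMem_empty _ h
  intro m n h
  induction m generalizing n with
  | zero =>
    cases n with
    | zero => rfl
    | succ n => exact absurd h.symm (h0 n)
  | succ m ih =>
    cases n with
    | zero => exact absurd h (h0 m)
    | succ n => rw [ih (ZFSet.singleton_injective h)]

/-- Subsets of `X` that are definable over `X` with parameters lie in `M`. -/
theorem sep_definable_mem (hX : IsTransClass X) {n : ℕ}
    (P : ∀ X : Set ZFSet.{u}, (Fin n → X) → X → Prop)
    [hP : Def (fun X (w : Fin (n + 1) → X) => P X (fun i => w i.castSucc) (w (Fin.last n)))]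
    (v : Fin n → X) : ZFSet.sep (fun x => ∃ h : x ∈ X, P X v ⟨x, h⟩) E ∈ M := by
  obtain ⟨φ, hφ⟩ := hP
  have hcM : ∀ n, tag n ∈ M := by
    intro n
    induction n with
    | zero => exact hM.empty_mem
    | succ n ih => exact hM.singleton_mem ih
  -- The required subset is the fibre over `v` of the truth set of `φ` on `(n + 1)`-tuples. The
  -- extra predicate does not occur and is interpreted by `∅`.
  obtain ⟨S, hS, h⟩ := isCoded_predRealize hM hE hEX hM.empty_mem hcM tag_injective
    (BoundedFormula.relabel Sum.inr (setLangHom.onFormula φ) :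
      setPredLang.BoundedFormula Empty (n + 1 + 0))
  obtain ⟨T, hT, h'⟩ := isCoded_true hM hcM hE hEX n
  have hv := hM.transitive _ hT _ ((h' _).2 ⟨v, rfl, trivial⟩)
  convert hM.sep_mem (fun (v : Fin 3 → _) x => ∃ t ∈ v 0, t = insert (ZFSet.pair (v 1) x) (v 2))
    ![S, tag n, tup tag fun i => (v i : ZFSet.{u})] (by simp [Fin.forall_fin_succ, hS, hcM, hv]) hE
    using 1
  ext x
  simp only [ZFSet.mem_sep, Matrix.cons_val, exists_eq_right]
  refine and_congr_right fun hx => ?_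
  have hxX := (hEX x).1 hx
  have := tup_snoc (c := tag) v ⟨x, hxX⟩
  change _ = insert (ZFSet.pair (tag n) x) _ at this
  rw [← this]
  refine Iff.trans ?_ (IsCoded.spec tag_injective h (Fin.snoc v ⟨x, hxX⟩)).symm
  unfold PredRealize
  let := predStructure X {x | x ∈ (∅ : ZFSet.{u})}
  rw [Formula.realize_relabel_sumInr, realize_onFormula_predStructure, hφ X hX]
  simp [hxX]

end truth

/-! ### Maps that preserve finitely many `Δ₀` predicates -/

/-- Names of the `Δ₀` predicates whose preservation is used to obtain full elementarity. -/
inductive Clause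
  | subsetUnion | disjoint | mem | ne | insertPair | encode | decode | allEmpty | cover | monotone
  | step | memAt | notMemAt | eqAt | neAt | predAt

instance : Finite Clause :=
  Finite.of_injective (fun i : Clause => (⟨i.ctorIdx, by cases i <;> decide⟩ : Fin 16)) (by
    intro i k
    cases i <;> cases k <;> simp [Clause.ctorIdx])

/-- The predicate with a given name. -/
def Clause.Holds : Clause → (Fin 6 → ZFSet.{u}) → Prop
  | subsetUnion, v => ∀ y ∈ v 0, y ∈ v 1 ∨ y ∈ v 2
  | disjoint, v => ∀ y ∈ v 0, ¬ y ∈ v 1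
  | mem, v => v 0 ∈ v 1
  | ne, v => ¬ v 0 = v 1
  | insertPair, v => v 0 = insert (ZFSet.pair (v 1) (v 2)) (v 3)
  | encode, v => ∀ s ∈ v 0, ∀ y ∈ v 1, ∃ t ∈ v 2, t = insert (ZFSet.pair (v 3) y) s
  | decode, v => ∀ t ∈ v 0, ∃ s ∈ v 1, ∃ y ∈ v 2, t = insert (ZFSet.pair (v 3) y) s
  | allEmpty, v => ∀ t ∈ v 0, ∀ y ∈ t, False
  | cover, v => ∀ s ∈ v 0, ∃ ξ ∈ v 1, ZFSet.pair ξ s ∈ v 2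
  | monotone, v => ∀ s ∈ v 0, ∀ ξ ∈ v 1, ∀ ζ ∈ v 1, ξ ∈ ζ →
      ZFSet.pair ξ s ∈ v 2 → ZFSet.pair ζ s ∈ v 2
  | step, v => ∀ s ∈ v 0, ZFSet.pair (v 1) s ∈ v 2 →
      ∃ y ∈ v 3, ∃ t ∈ v 4, t = insert (ZFSet.pair (v 5) y) s
  | memAt, v => ∀ t ∈ v 0, ∃ y ∈ v 3, ∃ z ∈ v 3,
      ZFSet.pair (v 1) y ∈ t ∧ ZFSet.pair (v 2) z ∈ t ∧ y ∈ z
  | notMemAt, v => ∀ t ∈ v 0, ∃ y ∈ v 3, ∃ z ∈ v 3,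
      ZFSet.pair (v 1) y ∈ t ∧ ZFSet.pair (v 2) z ∈ t ∧ ¬ y ∈ z
  | eqAt, v => ∀ t ∈ v 0, ∃ y ∈ v 3, ZFSet.pair (v 1) y ∈ t ∧ ZFSet.pair (v 2) y ∈ t
  | neAt, v => ∀ t ∈ v 0, ∃ y ∈ v 3, ∃ z ∈ v 3,
      ZFSet.pair (v 1) y ∈ t ∧ ZFSet.pair (v 2) z ∈ t ∧ ¬ y = z
  | predAt, v => ∀ t ∈ v 0, ∃ y ∈ v 2, ZFSet.pair (v 1) y ∈ t

instance (i : Clause) : D0 (n := 0) (fun v (_ : Fin 0 → ZFSet.{u}) => i.Holds v) := by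
  cases i <;> dsimp only [Clause.Holds] <;> infer_instance

/-- `J` preserves the listed `Δ₀` predicates on `X`. -/
def PreservesClauses (X : Set ZFSet.{u}) (J : ZFSet.{u} → ZFSet.{u}) : Prop :=
  ∀ (i : Clause) (v : Fin 6 → ZFSet.{u}), (∀ k, v k ∈ X) → i.Holds v → i.Holds (fun k => J (v k))

/-- `X` is a transitive subset of `M` that is closed under subsets (in `M`), unordered pairs,
unions and power sets. -/
structure IsClosedIn (M X : Set ZFSet.{u}) : Prop where
  le : X ⊆ M
  trans : IsTransClass X
  empty : ∅ ∈ X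
  subset : ∀ x ∈ X, ∀ y ∈ M, y ⊆ x → y ∈ X
  upair : ∀ x ∈ X, ∀ y ∈ X, ({x, y} : ZFSet.{u}) ∈ X
  sUnion : ∀ x ∈ X, ZFSet.sUnion x ∈ X
  pow : ∀ x ∈ X, powIn M x ∈ X

/-- `F` codes an increasing `μ`-sequence of subsets of `X`, each contained in an element of `X`,
with union `X`. -/
structure IsFiltration (X : Set ZFSet.{u}) (μ F : ZFSet.{u}) : Prop where
  cover : ∀ x ∈ X, ∃ ξ ∈ μ, ZFSet.pair ξ x ∈ F
  mono : ∀ ξ ∈ μ, ∀ ζ ∈ μ, ξ ∈ ζ → ∀ x ∈ X, ZFSet.pair ξ x ∈ F → ZFSet.pair ζ x ∈ F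
  bdd : ∀ ξ ∈ μ, ∃ w ∈ X, ∀ x ∈ X, ZFSet.pair ξ x ∈ F → x ∈ w

/-- The hypotheses under which a map that preserves the listed clauses is fully elementary. -/
structure IsFilteredMap (M X Y : Set ZFSet.{u}) (J : ZFSet.{u} → ZFSet.{u}) (E μ F : ZFSet.{u}) :
    Prop where
  model : IsTransitiveZFModel M
  set_mem : E ∈ M
  mem_set : ∀ x, x ∈ E ↔ x ∈ X
  closed : IsClosedIn M X
  trans : IsTransClass Y
  maps : ∀ x ∈ X, J x ∈ Y
  clauses : PreservesClauses X J
  cofinal : ∀ y ∈ Y, ∃ x ∈ X, y ∈ J x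
  mu_mem : μ ∈ X
  ordinal : μ.IsOrdinal
  map_mu : J μ = μ
  filt_mem : F ∈ M
  filt : IsFiltration X μ F

/-! ### Set operations inside a closed class. -/

namespace IsClosedIn

variable {M X : Set ZFSet.{u}} (hM : IsTransitiveZFModel M) (h : IsClosedIn M X) {x y : ZFSet.{u}}
include h

theorem singleton (hx : x ∈ X) : ({x} : ZFSet.{u}) ∈ X := by simpa using h.upair x hx x hx

theorem union (hx : x ∈ X) (hy : y ∈ X) : x ∪ y ∈ X := h.sUnion _ (h.upair x hx y hy)

theorem pair (hx : x ∈ X) (hy : y ∈ X) : ZFSet.pair x y ∈ X :=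
  h.upair _ (h.singleton hx) _ (h.upair x hx y hy)

theorem insert (hx : x ∈ X) (hy : y ∈ X) : Insert.insert x y ∈ X := by
  rw [ZFSet.insert_eq]
  exact h.union (h.singleton hx) hy

theorem tag_mem (n : ℕ) : tag n ∈ X := by
  induction n with
  | zero => exact h.empty
  | succ n ih => exact h.singleton ih

theorem tup_mem {n : ℕ} (xs : Fin n → X) : tup tag (fun i => (xs i : ZFSet.{u})) ∈ X := by
  induction n with
  | zero => simpa using h.empty
  | succ n ih =>
    rw [tup_succ]
    exact h.insert (h.pair (h.tag_mem n) (xs _).2) (ih fun i => xs i.castSucc)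

include hM

theorem inter (hx : x ∈ X) (hy : y ∈ M) : x ∩ y ∈ X :=
  h.subset x hx _ (hM.inter_mem (h.le hx) hy) fun _ hz => (ZFSet.mem_inter.1 hz).1

theorem sdiff (hx : x ∈ X) (hy : y ∈ M) : x \ y ∈ X :=
  h.subset x hx _ (hM.sdiff_mem (h.le hx) hy) fun _ hz => (ZFSet.mem_sdiff.1 hz).1

/-- Separation inside `X` for `Δ₀` predicates. -/
theorem sep {α : Type} (P : (α → ZFSet.{u}) → ZFSet.{u} → Prop)
    [D0 (fun v (xs : Fin 1 → ZFSet.{u}) => P v (xs 0))]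
    (v : α → ZFSet.{u}) (hv : ∀ i, v i ∈ M) (hx : x ∈ X) : ZFSet.sep (P v) x ∈ X :=
  h.subset x hx _ (hM.sep_mem P v hv (h.le hx)) ZFSet.sep_subset

/-- The set of all extensions of the codes in `x` by an entry from `y`. -/
theorem exists_extensions {c : ZFSet.{u}} (hc : c ∈ X) (hx : x ∈ X) (hy : y ∈ X) :
    ∃ z ∈ X, ∀ t, t ∈ z ↔ ∃ s ∈ x, ∃ u ∈ y, t = Insert.insert (ZFSet.pair c u) s := by
  have hcy := h.union (h.singleton hc) hy
  refine ⟨_, h.sep hM (fun (v : Fin 3 → _) t => ∃ s ∈ v 0, ∃ u ∈ v 1,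
    t = Insert.insert (ZFSet.pair (v 2) u) s) ![x, y, c] ?_
    -- An extended code consists of elements of `⋃ x` and one pair from the double power set of `{c}
    -- ∪ y`.
    (h.pow _ (h.union (h.sUnion _ hx) (h.pow _ (h.pow _ hcy)))), fun t => ?_⟩
  · simp [Fin.forall_fin_succ, h.le hx, h.le hy, h.le hc]
  · rw [ZFSet.mem_sep]
    refine ⟨fun H => H.2, fun H => ⟨?_, H⟩⟩
    obtain ⟨s, hs, u, hu, rfl⟩ := H
    have hs' := h.trans _ hx _ hs
    have hu' := h.trans _ hy _ hu
    rw [mem_powIn]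
    refine ⟨fun z hz => ?_, h.le (h.insert (h.pair hc hu') hs')⟩
    rw [ZFSet.mem_insert_iff] at hz
    rw [ZFSet.mem_union]
    rcases hz with rfl | hz
    · exact Or.inr (hM.pair_mem_powIn (h.le hcy) (by simp) (by simp [hu]))
    · exact Or.inl (ZFSet.mem_sUnion_of_mem hz hs)

end IsClosedIn

/-- A set that contains the entries of the codes in `x`. -/
def entries (x : ZFSet.{u}) : ZFSet.{u} := ZFSet.sUnion (ZFSet.sUnion (ZFSet.sUnion x))

theorem mem_entries {x t c y : ZFSet.{u}} (ht : t ∈ x) (hy : ZFSet.pair c y ∈ t) :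
    y ∈ entries x :=
  ZFSet.mem_sUnion_of_mem (z := {c, y}) (by simp) (ZFSet.mem_sUnion_of_mem (z := ZFSet.pair c y)
    (by simp [ZFSet.pair]) (ZFSet.mem_sUnion_of_mem hy ht))

/-- Every element of the image of a set of codes of `R`-tuples is a code of an `R'`-tuple. -/
def Transfers (X Y : Set ZFSet.{u}) (J : ZFSet.{u} → ZFSet.{u}) {n : ℕ} (R : (Fin n → X) → Prop)
    (R' : (Fin n → Y) → Prop) : Prop :=
  ∀ x ∈ X, (∀ t ∈ x, ∃ xs : Fin n → X, t = tup tag (fun i => xs i) ∧ R xs) →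
    ∀ t ∈ J x, ∃ ys : Fin n → Y, t = tup (J ∘ tag) (fun i => ys i) ∧ R' ys

theorem Transfers.congr {X Y : Set ZFSet.{u}} {J : ZFSet.{u} → ZFSet.{u}} {n : ℕ}
    {R S : (Fin n → X) → Prop} {R' S' : (Fin n → Y) → Prop} (h : Transfers X Y J R R')
    (hS : ∀ xs, S xs ↔ R xs) (hS' : ∀ xs, S' xs ↔ R' xs) : Transfers X Y J S S' := by
  rwa [show S = R from funext fun xs => propext (hS xs),
    show S' = R' from funext fun xs => propext (hS' xs)]

/-! ### Transfer of formulas along a filtered map. -/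

namespace IsFilteredMap

variable {M X Y : Set ZFSet.{u}} {J : ZFSet.{u} → ZFSet.{u}} {E μ F : ZFSet.{u}}
  (h : IsFilteredMap M X Y J E μ F)
include h

theorem map_ne {x y : ZFSet.{u}} (hx : x ∈ X) (hy : y ∈ X) (hxy : x ≠ y) : J x ≠ J y :=
  -- Here and below, slots that a clause does not read are filled with an arbitrary element of `X`.
  h.clauses .ne ![x, y, x, x, x, x] (by simp [Fin.forall_fin_succ, hx, hy]) hxy

theorem map_mem {x y : ZFSet.{u}} (hx : x ∈ X) (hy : y ∈ X) (hxy : x ∈ y) : J x ∈ J y :=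
  h.clauses .mem ![x, y, x, x, x, x] (by simp [Fin.forall_fin_succ, hx, hy]) hxy

theorem disjoint_map {x y : ZFSet.{u}} (hx : x ∈ X) (hy : y ∈ X) (hxy : ∀ z ∈ x, z ∉ y) :
    ∀ z ∈ J x, z ∉ J y :=
  h.clauses .disjoint ![x, y, x, x, x, x] (by simp [Fin.forall_fin_succ, hx, hy]) hxy

/-- `∅` is disjoint from itself, and disjointness is preserved. -/
theorem map_empty : J ∅ = ∅ :=
  (ZFSet.eq_empty _).2 fun y hy =>
    h.disjoint_map h.closed.empty h.closed.empty (fun z hz => absurd hz (ZFSet.notMem_empty z))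
      y hy hy

theorem tag_injective : Function.Injective (J ∘ tag) := by
  intro m n e
  by_contra hmn
  exact h.map_ne (h.closed.tag_mem m) (h.closed.tag_mem n) (RankEmb.tag_injective.ne hmn) e

/-- The image code carries the tags `J ∘ tag`. It suffices that these remain distinct, so it is
never needed that `J` fixes the tags. -/
theorem map_tup {n : ℕ} (xs : Fin n → X) :
    J (tup tag (fun i => (xs i : ZFSet.{u}))) = tup (J ∘ tag) (fun i => J (xs i)) := by
  induction n with
  | zero => simpa using h.map_empty
  | succ n ih =>
    rw [tup_succ, tup_succ, ← ih fun i => xs i.castSucc]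
    have h1 := h.closed.tup_mem fun i => xs i.castSucc
    have h2 := h.closed.tup_mem xs
    rw [tup_succ] at h2
    exact h.clauses .insertPair
      ![_, tag n, xs (Fin.last n), tup tag (fun i => (xs i.castSucc : ZFSet.{u})), ∅, ∅]
      (by simp only [Fin.forall_fin_succ, Matrix.cons_val_zero, Matrix.cons_val_succ]
          exact ⟨h2, h.closed.tag_mem n, (xs _).2, h1, h.closed.empty, h.closed.empty,
            fun i => i.elim0⟩) rfl

theorem entries_mem {x : ZFSet.{u}} (hx : x ∈ X) :
    entries x ∈ X :=
  h.closed.sUnion _ (h.closed.sUnion _ (h.closed.sUnion _ hx))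

theorem isCoded_true (n : ℕ) : IsCoded M tag (fun _ : Fin n → X => True) :=
  RankEmb.isCoded_true h.model (fun n => h.closed.le (h.closed.tag_mem n)) h.set_mem h.mem_set n

/-- Guarantees that elements of `J x` are codes at all, so that the other transfer lemmas can start
from a tuple in `Y`. -/
theorem transfers_true (n : ℕ) :
    Transfers X Y J (fun _ : Fin n → X => True) (fun _ : Fin n → Y => True) := by
  induction n with
  | zero =>
    intro x hx hR t ht
    have : ∀ t ∈ J x, ∀ y ∈ t, False :=
      h.clauses .allEmpty ![x, x, x, x, x, x] (by simp [Fin.forall_fin_succ, hx]) fun t ht y hy => by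
        obtain ⟨xs, rfl, -⟩ := hR t ht
        simp at hy
    refine ⟨Fin.elim0, ?_, trivial⟩
    rw [tup_zero, ZFSet.eq_empty]
    exact this t ht
  | succ n ih =>
    intro x hx hR t ht
    obtain ⟨T, hT, hT'⟩ := h.isCoded_true n
    -- Dropping the last entry of a code in `x` leaves a subset of `⋃ x` that lies in `T`; this set
    -- collects all of these truncations.
    have hx0 := h.closed.inter h.model (h.closed.pow _ (h.closed.sUnion _ hx)) hT
    have hc := h.closed.tag_mem n
    have hw := h.entries_mem hx
    have key : ∀ t ∈ J x, ∃ s ∈ J (powIn M (ZFSet.sUnion x) ∩ T), ∃ y ∈ J (entries x),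
        t = insert (ZFSet.pair (J (tag n)) y) s :=
      h.clauses .decode ![x, _, entries x, tag n, x, x] (by simp [Fin.forall_fin_succ, hx, hx0, hc, hw])
      (fun t ht => by
        obtain ⟨xs, rfl, -⟩ := hR t ht
        have h1 := (hT' _).2 ⟨fun i => xs i.castSucc, rfl, trivial⟩
        refine ⟨_, ZFSet.mem_inter.2 ⟨mem_powIn.2 ⟨fun z hz => ?_, h.model.transitive _ hT _ h1⟩, h1⟩,
          xs (Fin.last n), mem_entries ht (c := tag n) ?_, tup_succ _⟩
        · refine ZFSet.mem_sUnion_of_mem ?_ ht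
          rw [tup_succ]
          exact ZFSet.mem_insert_of_mem _ hz
        · rw [tup_succ]
          exact ZFSet.mem_insert _ _)
    obtain ⟨s, hs, y, hy, rfl⟩ := key t ht
    obtain ⟨ys, rfl, -⟩ := ih _ hx0 (fun t ht => by
      obtain ⟨xs, e, -⟩ := (hT' t).1 (ZFSet.mem_inter.1 ht).2
      exact ⟨xs, e, trivial⟩) s hs
    have hyY := h.trans _ (h.maps _ hw) _ hy
    exact ⟨Fin.snoc ys ⟨y, hyY⟩, (tup_snoc ys ⟨y, hyY⟩).symm, trivial⟩

variable {n : ℕ} {R S : (Fin n → X) → Prop} {R' S' : (Fin n → Y) → Prop}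

/-- Elements of the image of a set of codes are codes. -/
theorem exists_eq_tup {x t : ZFSet.{u}} (hx : x ∈ X)
    (hR : ∀ t ∈ x, ∃ xs : Fin n → X, t = tup tag (fun i => xs i) ∧ R xs) (ht : t ∈ J x) :
    ∃ ys : Fin n → Y, t = tup (J ∘ tag) (fun i => ys i) := by
  obtain ⟨ys, e, -⟩ := h.transfers_true n x hx (fun t ht => by
    obtain ⟨xs, e, -⟩ := hR t ht
    exact ⟨xs, e, trivial⟩) t ht
  exact ⟨ys, e⟩

theorem tup_inj {ys zs : Fin n → Y}
    (e : tup (J ∘ tag) (fun i => (ys i : ZFSet.{u})) = tup (J ∘ tag) (fun i => (zs i : ZFSet.{u}))) :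
    ys = zs := by
  have := tup_injective h.tag_injective e
  exact funext fun i => Subtype.ext (congrFun this i)

theorem transfers_and (hR : Transfers X Y J R R') (hS : Transfers X Y J S S') :
    Transfers X Y J (fun xs => R xs ∧ S xs) (fun ys => R' ys ∧ S' ys) := by
  intro x hx hRS t ht
  obtain ⟨ys, rfl, h1⟩ := hR x hx (fun t ht => by
    obtain ⟨xs, e, h1, -⟩ := hRS t ht
    exact ⟨xs, e, h1⟩) t ht
  obtain ⟨zs, e, h2⟩ := hS x hx (fun t ht => by
    obtain ⟨xs, e, -, h1⟩ := hRS t ht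
    exact ⟨xs, e, h1⟩) _ ht
  exact ⟨ys, rfl, h1, h.tup_inj e ▸ h2⟩

/-- The truth set of `R` splits `x` into two elements of `X`, and `J` preserves the covering of `x`
by these. -/
theorem transfers_or (hR : Transfers X Y J R R') (hS : Transfers X Y J S S')
    (hc : IsCoded M tag R) :
    Transfers X Y J (fun xs => R xs ∨ S xs) (fun ys => R' ys ∨ S' ys) := by
  intro x hx hRS t ht
  obtain ⟨T, hT, hT'⟩ := hc
  have h1 := h.closed.inter h.model hx hT
  have h2 := h.closed.sdiff h.model hx hT
  have key : ∀ t ∈ J x, t ∈ J (x ∩ T) ∨ t ∈ J (x \ T) :=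
    h.clauses .subsetUnion ![x, _, _, x, x, x] (by simp [Fin.forall_fin_succ, hx, h1, h2])
      fun t ht => by
        change t ∈ x ∩ T ∨ t ∈ x \ T
        rw [ZFSet.mem_inter, ZFSet.mem_sdiff]
        tauto
  rcases key t ht with ht | ht
  · obtain ⟨ys, e, h3⟩ := hR _ h1 (fun t ht => (hT' t).1 (ZFSet.mem_inter.1 ht).2) t ht
    exact ⟨ys, e, Or.inl h3⟩
  · obtain ⟨ys, e, h3⟩ := hS _ h2 (fun t ht => by
      rw [ZFSet.mem_sdiff] at ht
      obtain ⟨xs, e, h3 | h3⟩ := hRS t ht.1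
      · exact absurd ((hT' t).2 ⟨xs, e, h3⟩) ht.2
      · exact ⟨xs, e, h3⟩) t ht
    exact ⟨ys, e, Or.inr h3⟩

/-- By cofinality a given `y ∈ Y` lies in some `J w`; all extensions of codes in `x` by elements of
`w` form a set `z ∈ X` to which the hypothesis on `R` applies. -/
theorem transfers_all {R : (Fin (n + 1) → X) → Prop} {R' : (Fin (n + 1) → Y) → Prop}
    (hR : Transfers X Y J R R') :
    Transfers X Y J (fun xs : Fin n → X => ∀ y, R (Fin.snoc xs y))
      (fun ys : Fin n → Y => ∀ y, R' (Fin.snoc ys y)) := by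
  intro x hx hRx t ht
  obtain ⟨ys, rfl⟩ := h.exists_eq_tup hx hRx ht
  refine ⟨ys, rfl, fun y => ?_⟩
  obtain ⟨w, hw, hyw⟩ := h.cofinal y y.2
  have hc := h.closed.tag_mem n
  obtain ⟨z, hz, hz'⟩ := h.closed.exists_extensions h.model hc hx hw
  have key : ∀ s ∈ J x, ∀ y ∈ J w, ∃ t ∈ J z, t = insert (ZFSet.pair (J (tag n)) y) s :=
    h.clauses .encode ![x, w, z, tag n, x, x] (by simp [Fin.forall_fin_succ, hx, hw, hz, hc])
      fun s hs y hy => ⟨_, (hz' _).2 ⟨s, hs, y, hy, rfl⟩, rfl⟩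
  obtain ⟨t', ht', e⟩ := key _ ht y hyw
  obtain ⟨zs, rfl, h1⟩ := hR z hz (fun t ht => by
    obtain ⟨s, hs, y, hy, rfl⟩ := (hz' t).1 ht
    obtain ⟨xs, rfl, h1⟩ := hRx s hs
    have hy' := h.closed.trans _ hw _ hy
    exact ⟨Fin.snoc xs ⟨y, hy'⟩, (tup_snoc xs ⟨y, hy'⟩).symm, h1 _⟩) t' ht'
  rw [← show zs = Fin.snoc ys y from h.tup_inj (e.trans (tup_snoc ys y).symm)]
  exact h1

/-- An ordinal below `μ` is not moved below itself. -/
theorem subset_map {ξ : ZFSet.{u}} (hξ : ξ ∈ μ) : J ξ ∈ μ ∧ ξ ⊆ J ξ := by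
  have hX : ∀ ξ ∈ μ, ξ ∈ X := fun ξ hξ => h.closed.trans _ h.mu_mem _ hξ
  have hμ : ∀ ξ ∈ μ, J ξ ∈ μ := fun ξ hξ => by
    have := h.map_mem (hX ξ hξ) h.mu_mem hξ
    rwa [h.map_mu] at this
  refine ⟨hμ ξ hξ, ?_⟩
  induction ξ using ZFSet.inductionOn with
  | _ ξ ih =>
  -- If `J ξ ∈ ξ`, the induction hypothesis at `J ξ` gives `J ξ ⊆ J (J ξ)`, while `J (J ξ) ∈ J ξ`;
  -- so `J (J ξ)` would be an element of itself.
  rcases (h.ordinal.mem (hμ ξ hξ)).mem_or_subset (h.ordinal.mem hξ) with h1 | h1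
  · have h2 := ih _ h1 (hμ ξ hξ)
    exact absurd (h2 (h.map_mem (hX _ (hμ ξ hξ)) (hX ξ hξ) h1)) (ZFSet.mem_irrefl _)
  · exact h1

/-- The only place where the filtration and `J μ = μ` enter: they replace the bound on witnesses
that collection would give. -/
theorem transfers_ex {R : (Fin (n + 1) → X) → Prop} {R' : (Fin (n + 1) → Y) → Prop}
    (hR : Transfers X Y J R R') (hcR : IsCoded M tag R) :
    Transfers X Y J (fun xs : Fin n → X => ∃ y, R (Fin.snoc xs y))
      (fun ys : Fin n → Y => ∃ y, R' (Fin.snoc ys y)) := by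
  intro x hx hRx t ht
  obtain ⟨ys, rfl⟩ := h.exists_eq_tup hx hRx ht
  obtain ⟨T, hT, hT'⟩ := hcR
  have hc := h.closed.tag_mem n
  have hxM := h.closed.le hx
  -- `C` relates a stage `ξ` to the codes in `x` that have a witness at that stage.
  obtain ⟨C, hC, hC'⟩ : ∃ C ∈ X, ∀ ξ s, ZFSet.pair ξ s ∈ C ↔ ξ ∈ μ ∧ s ∈ x ∧
      ∃ y ∈ E, ZFSet.pair ξ y ∈ F ∧ insert (ZFSet.pair (tag n) y) s ∈ T := by
    have hμx := h.closed.union h.mu_mem hx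
    refine ⟨_, h.closed.sep h.model (fun (v : Fin 6 → _) z => ∃ ξ ∈ v 0, ∃ s ∈ v 1,
      z = ZFSet.pair ξ s ∧ ∃ y ∈ v 2, ZFSet.pair ξ y ∈ v 3 ∧
        ∃ t ∈ v 4, t = insert (ZFSet.pair (v 5) y) s) ![μ, x, E, F, T, tag n] ?_
      (h.closed.pow _ (h.closed.pow _ hμx)), fun ξ s => ?_⟩
    · simp [Fin.forall_fin_succ, h.closed.le h.mu_mem, hxM, h.set_mem, h.filt_mem, hT, h.closed.le hc]
    · simp only [ZFSet.mem_sep, Matrix.cons_val, exists_eq_right]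
      constructor
      · rintro ⟨-, ξ', hξ, s', hs, e, h1⟩
        obtain ⟨rfl, rfl⟩ := ZFSet.pair_inj.1 e
        exact ⟨hξ, hs, h1⟩
      · rintro ⟨hξ, hs, h1⟩
        exact ⟨h.model.pair_mem_powIn (h.closed.le hμx) (by simp [hξ]) (by simp [hs]),
          ξ, hξ, s, hs, rfl, h1⟩
  have hcover : ∀ s ∈ J x, ∃ ξ ∈ J μ, ZFSet.pair ξ s ∈ J C :=
    h.clauses .cover ![x, μ, C, x, x, x] (by simp [Fin.forall_fin_succ, hx, h.mu_mem, hC])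
      fun s hs => by
        obtain ⟨xs, rfl, y, hy⟩ := hRx s hs
        obtain ⟨ξ, hξ, hξy⟩ := h.filt.cover y y.2
        refine ⟨ξ, hξ, (hC' _ _).2 ⟨hξ, hs, y, (h.mem_set _).2 y.2, hξy, ?_⟩⟩
        exact (hT' _).2 ⟨_, (tup_snoc xs y).symm, hy⟩
  have hmono : ∀ s ∈ J x, ∀ ξ ∈ J μ, ∀ ζ ∈ J μ, ξ ∈ ζ →
      ZFSet.pair ξ s ∈ J C → ZFSet.pair ζ s ∈ J C :=
    h.clauses .monotone ![x, μ, C, x, x, x] (by simp [Fin.forall_fin_succ, hx, h.mu_mem, hC])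
      fun s hs ξ hξ ζ hζ hξζ h1 => by
        obtain ⟨-, -, y, hy, h2, h3⟩ := (hC' _ _).1 h1
        exact (hC' _ _).2 ⟨hζ, hs, y, hy, h.filt.mono ξ hξ ζ hζ hξζ y ((h.mem_set _).1 hy) h2, h3⟩
  rw [h.map_mu] at hcover hmono
  obtain ⟨ξ, hξ, hξt⟩ := hcover _ ht
  obtain ⟨hJξ, hle⟩ := h.subset_map hξ
  -- The index `ξ` need not be in the range of `J`. Passing up to `J ξ ≥ ξ` makes the clause for the
  -- single stage `ξ` applicable.
  have hJξt : ZFSet.pair (J ξ) (tup (J ∘ tag) fun i => (ys i : ZFSet.{u})) ∈ J C := by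
    rcases ((h.ordinal.mem hξ).subset_iff_eq_or_mem (h.ordinal.mem hJξ)).1 hle with e | h1
    · rwa [← e]
    · exact hmono _ ht ξ hξ _ hJξ h1 hξt
  obtain ⟨w, hw, hw'⟩ := h.filt.bdd ξ hξ
  obtain ⟨z, hz, hz'⟩ := h.closed.exists_extensions h.model hc hx hw
  have hzT := h.closed.inter h.model hz hT
  have hξX := h.closed.trans _ h.mu_mem _ hξ
  -- In `X`, codes with a witness at stage `ξ` have one in the bound `w`, and the extended code lies
  -- in `z ∩ T`; this is a `Δ₀` statement about `ξ`.
  have key : ∀ s ∈ J x, ZFSet.pair (J ξ) s ∈ J C → ∃ y ∈ J w, ∃ t ∈ J (z ∩ T),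
      t = insert (ZFSet.pair (J (tag n)) y) s :=
    h.clauses .step ![x, ξ, C, w, z ∩ T, tag n]
      (by simp [Fin.forall_fin_succ, hx, hξX, hC, hw, hzT, hc]) fun s hs h1 => by
        obtain ⟨-, -, y, hy, h2, h3⟩ := (hC' _ _).1 h1
        have hyw := hw' y ((h.mem_set _).1 hy) h2
        exact ⟨y, hyw, _, ZFSet.mem_inter.2 ⟨(hz' _).2 ⟨s, hs, y, hyw, rfl⟩, h3⟩, rfl⟩
  obtain ⟨y, hy, t', ht', e⟩ := key _ ht hJξt
  have hyY := h.trans _ (h.maps _ hw) _ hy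
  obtain ⟨zs, rfl, h1⟩ := hR _ hzT (fun t ht => (hT' t).1 (ZFSet.mem_inter.1 ht).2) t' ht'
  refine ⟨ys, rfl, ⟨y, hyY⟩, ?_⟩
  rw [← show zs = Fin.snoc ys ⟨y, hyY⟩ from h.tup_inj (e.trans (tup_snoc ys ⟨y, hyY⟩).symm)]
  exact h1

omit h in
theorem entry_mem {x : ZFSet.{u}} (i : Fin n) (xs : Fin n → X)
    (hx : tup tag (fun i => (xs i : ZFSet.{u})) ∈ x) :
    (xs i : ZFSet.{u}) ∈ entries x ∧
      ZFSet.pair (tag i) (xs i) ∈ tup tag (fun i => (xs i : ZFSet.{u})) := by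
  have h1 := (pair_mem_tup RankEmb.tag_injective (xs := fun i => (xs i : ZFSet.{u})) (i := i)).2 rfl
  exact ⟨mem_entries hx h1, h1⟩

theorem eq_of_pair_mem {ys : Fin n → Y} {i : Fin n} {y : ZFSet.{u}}
    (hy : ZFSet.pair (J (tag i)) y ∈ tup (J ∘ tag) (fun i => (ys i : ZFSet.{u}))) : y = ys i :=
  (pair_mem_tup h.tag_injective).1 hy

theorem transfers_mem (i k : Fin n) :
    Transfers X Y J (fun xs => (xs i : ZFSet.{u}) ∈ (xs k : ZFSet.{u}))
      (fun ys => (ys i : ZFSet.{u}) ∈ (ys k : ZFSet.{u})) := by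
  intro x hx hRx t ht
  obtain ⟨ys, rfl⟩ := h.exists_eq_tup hx hRx ht
  have key : ∀ t ∈ J x, ∃ y ∈ J (entries x), ∃ z ∈ J (entries x),
      ZFSet.pair (J (tag i)) y ∈ t ∧ ZFSet.pair (J (tag k)) z ∈ t ∧ y ∈ z :=
    h.clauses .memAt ![x, tag i, tag k, entries x, x, x]
      (by simp [Fin.forall_fin_succ, hx, h.closed.tag_mem, h.entries_mem hx]) fun t ht => by
        obtain ⟨xs, rfl, h1⟩ := hRx t ht
        exact ⟨_, (entry_mem i xs ht).1, _, (entry_mem k xs ht).1, (entry_mem i xs ht).2,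
          (entry_mem k xs ht).2, h1⟩
  obtain ⟨y, -, z, -, hy, hz, h1⟩ := key _ ht
  exact ⟨ys, rfl, by rwa [h.eq_of_pair_mem hy, h.eq_of_pair_mem hz] at h1⟩

/-- Clauses are assumed to be preserved but not reflected, so a negated atomic formula needs its own
clause. -/
theorem transfers_notMem (i k : Fin n) :
    Transfers X Y J (fun xs => ¬ (xs i : ZFSet.{u}) ∈ (xs k : ZFSet.{u}))
      (fun ys => ¬ (ys i : ZFSet.{u}) ∈ (ys k : ZFSet.{u})) := by
  intro x hx hRx t ht
  obtain ⟨ys, rfl⟩ := h.exists_eq_tup hx hRx ht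
  have key : ∀ t ∈ J x, ∃ y ∈ J (entries x), ∃ z ∈ J (entries x),
      ZFSet.pair (J (tag i)) y ∈ t ∧ ZFSet.pair (J (tag k)) z ∈ t ∧ ¬ y ∈ z :=
    h.clauses .notMemAt ![x, tag i, tag k, entries x, x, x]
      (by simp [Fin.forall_fin_succ, hx, h.closed.tag_mem, h.entries_mem hx]) fun t ht => by
        obtain ⟨xs, rfl, h1⟩ := hRx t ht
        exact ⟨_, (entry_mem i xs ht).1, _, (entry_mem k xs ht).1, (entry_mem i xs ht).2,
          (entry_mem k xs ht).2, h1⟩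
  obtain ⟨y, -, z, -, hy, hz, h1⟩ := key _ ht
  exact ⟨ys, rfl, by rwa [h.eq_of_pair_mem hy, h.eq_of_pair_mem hz] at h1⟩

theorem transfers_eq (i k : Fin n) :
    Transfers X Y J (fun xs => xs i = xs k) (fun ys => ys i = ys k) := by
  intro x hx hRx t ht
  obtain ⟨ys, rfl⟩ := h.exists_eq_tup hx hRx ht
  have key : ∀ t ∈ J x, ∃ y ∈ J (entries x),
      ZFSet.pair (J (tag i)) y ∈ t ∧ ZFSet.pair (J (tag k)) y ∈ t :=
    h.clauses .eqAt ![x, tag i, tag k, entries x, x, x]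
      (by simp [Fin.forall_fin_succ, hx, h.closed.tag_mem, h.entries_mem hx]) fun t ht => by
        obtain ⟨xs, rfl, h1⟩ := hRx t ht
        have h2 := (entry_mem k xs ht).2
        rw [← h1] at h2
        exact ⟨_, (entry_mem i xs ht).1, (entry_mem i xs ht).2, h2⟩
  obtain ⟨y, -, hy, hz⟩ := key _ ht
  exact ⟨ys, rfl, Subtype.ext ((h.eq_of_pair_mem hy).symm.trans (h.eq_of_pair_mem hz))⟩

theorem transfers_ne (i k : Fin n) :
    Transfers X Y J (fun xs => ¬ xs i = xs k) (fun ys => ¬ ys i = ys k) := by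
  intro x hx hRx t ht
  obtain ⟨ys, rfl⟩ := h.exists_eq_tup hx hRx ht
  have key : ∀ t ∈ J x, ∃ y ∈ J (entries x), ∃ z ∈ J (entries x),
      ZFSet.pair (J (tag i)) y ∈ t ∧ ZFSet.pair (J (tag k)) z ∈ t ∧ ¬ y = z :=
    h.clauses .neAt ![x, tag i, tag k, entries x, x, x]
      (by simp [Fin.forall_fin_succ, hx, h.closed.tag_mem, h.entries_mem hx]) fun t ht => by
        obtain ⟨xs, rfl, h1⟩ := hRx t ht
        exact ⟨_, (entry_mem i xs ht).1, _, (entry_mem k xs ht).1, (entry_mem i xs ht).2,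
          (entry_mem k xs ht).2, fun e => h1 (Subtype.ext e)⟩
  obtain ⟨y, -, z, -, hy, hz, h1⟩ := key _ ht
  refine ⟨ys, rfl, fun e => h1 ?_⟩
  rw [h.eq_of_pair_mem hy, h.eq_of_pair_mem hz, e]

/-- If the `i`-th entries of the codes in `x` lie in `B`, so do those of the codes in `J x`, up to
an element of `X` contained in `B`. -/
theorem exists_map_entry {B : ZFSet.{u}} (i : Fin n) {x : ZFSet.{u}} (hx : x ∈ X)
    (hB : entries x ∩ B ∈ X)
    (hRx : ∀ t ∈ x, ∃ xs : Fin n → X, t = tup tag (fun i => xs i) ∧ (xs i : ZFSet.{u}) ∈ B)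
    {ys : Fin n → Y} (ht : tup (J ∘ tag) (fun i => (ys i : ZFSet.{u})) ∈ J x) :
    (ys i : ZFSet.{u}) ∈ J (entries x ∩ B) := by
  have key : ∀ t ∈ J x, ∃ y ∈ J (entries x ∩ B),
      ZFSet.pair (J (tag i)) y ∈ t :=
    h.clauses .predAt ![x, tag i, _, x, x, x]
      (by simp [Fin.forall_fin_succ, hx, h.closed.tag_mem, hB]) fun t ht => by
        obtain ⟨xs, rfl, h1⟩ := hRx t ht
        exact ⟨_, ZFSet.mem_inter.2 ⟨(entry_mem i xs ht).1, h1⟩, (entry_mem i xs ht).2⟩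
  obtain ⟨y, hy, h1⟩ := key _ ht
  rwa [← h.eq_of_pair_mem h1]

variable {A : ZFSet.{u}} {B : Set ZFSet.{u}}

theorem transfers_pred (hA : A ∈ M) (hB : ∀ y ∈ Y, y ∈ B ↔ ∃ x ∈ X, x ⊆ A ∧ y ∈ J x) (i : Fin n) :
    Transfers X Y J (fun xs => (xs i : ZFSet.{u}) ∈ A) (fun ys => (ys i : ZFSet.{u}) ∈ B) := by
  intro x hx hRx t ht
  obtain ⟨ys, rfl⟩ := h.exists_eq_tup hx hRx ht
  have hw := h.closed.inter h.model (h.entries_mem hx) hA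
  exact ⟨ys, rfl, (hB _ (ys i).2).2 ⟨_, hw, fun z hz => (ZFSet.mem_inter.1 hz).2,
    h.exists_map_entry i hx hw hRx ht⟩⟩

/-- The entries concerned lie in a set in `X` that is contained in `E \ A`. It is disjoint from
every `x' ⊆ A` in `X`, and disjointness is preserved. -/
theorem transfers_notPred (hA : A ∈ M) (hB : ∀ y ∈ Y, y ∈ B ↔ ∃ x ∈ X, x ⊆ A ∧ y ∈ J x)
    (i : Fin n) :
    Transfers X Y J (fun xs => ¬ (xs i : ZFSet.{u}) ∈ A) (fun ys => ¬ (ys i : ZFSet.{u}) ∈ B) := by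
  intro x hx hRx t ht
  obtain ⟨ys, rfl⟩ := h.exists_eq_tup hx hRx ht
  have hEA := h.model.sdiff_mem h.set_mem hA
  have hw := h.closed.inter h.model (h.entries_mem hx) hEA
  have h1 := h.exists_map_entry i hx hw (fun t ht => by
    obtain ⟨xs, e, h1⟩ := hRx t ht
    exact ⟨xs, e, ZFSet.mem_sdiff.2 ⟨(h.mem_set _).2 (xs i).2, h1⟩⟩) ht
  refine ⟨ys, rfl, fun h2 => ?_⟩
  obtain ⟨x', hx', hx'A, h3⟩ := (hB _ (ys i).2).1 h2
  refine h.disjoint_map hw hx' (fun z hz hz' => ?_) _ h1 h3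
  exact (ZFSet.mem_sdiff.1 (ZFSet.mem_inter.1 hz).2).2 (hx'A hz')

/-- Both signs are carried through the induction because implication and negated universal
quantification use the opposite sign of a subformula: `φ → ψ` is treated as `¬φ ∨ ψ`, and `¬∀` as
`∃¬`. -/
theorem transfers_predRealize (hA : A ∈ M) (hB : ∀ y ∈ Y, y ∈ B ↔ ∃ x ∈ X, x ⊆ A ∧ y ∈ J x)
    (φ : setPredLang.BoundedFormula Empty n) :
    Transfers X Y J (PredRealize X {x | x ∈ A} φ) (PredRealize Y B φ) ∧
      Transfers X Y J (fun xs => ¬ PredRealize X {x | x ∈ A} φ xs)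
        (fun ys => ¬ PredRealize Y B φ ys) := by
  have hcM : ∀ n, tag n ∈ M := fun n => h.closed.le (h.closed.tag_mem n)
  have hcoded : ∀ {n : ℕ} (φ : setPredLang.BoundedFormula Empty n),
      IsCoded M tag (PredRealize X {x | x ∈ A} φ) := fun φ =>
    isCoded_predRealize h.model h.set_mem h.mem_set hA hcM RankEmb.tag_injective φ
  have hnot : ∀ {n : ℕ} (φ : setPredLang.BoundedFormula Empty n),
      IsCoded M tag (fun xs => ¬ PredRealize X {x | x ∈ A} φ xs) := fun φ =>
    (hcoded φ).not h.model hcM RankEmb.tag_injective h.set_mem h.mem_set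
  induction φ using predFormula_induction with
  | falsum n =>
    refine ⟨fun x hx hR t ht => ?_, (h.transfers_true n).congr (fun _ => by simp [predRealize_falsum])
      fun _ => by simp [predRealize_falsum]⟩
    -- No tuple satisfies falsum, so `x` is empty and thus disjoint from itself; hence so is `J x`.
    refine absurd ht (h.disjoint_map hx hx (fun t ht => ?_) t ht)
    obtain ⟨_, _, h1⟩ := hR t ht
    exact h1.elim
  | equal n i k => exact ⟨h.transfers_eq i k, h.transfers_ne i k⟩
  | mem n i k => exact ⟨h.transfers_mem i k, h.transfers_notMem i k⟩
  | pred n i => exact ⟨h.transfers_pred hA hB i, h.transfers_notPred hA hB i⟩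
  | imp n φ ψ h1 h2 =>
    exact ⟨(h.transfers_or h1.2 h2.1 (hnot φ)).congr (fun _ => imp_iff_not_or)
      fun _ => imp_iff_not_or,
      (h.transfers_and h1.1 h2.2).congr (fun _ => Classical.not_imp) fun _ => Classical.not_imp⟩
  | all n φ h1 =>
    exact ⟨h.transfers_all h1.1, (h.transfers_ex h1.2 (hnot φ)).congr (fun _ => not_forall)
      fun _ => not_forall⟩

theorem isPredElementary (hA : A ∈ M) (hB : ∀ y ∈ Y, y ∈ B ↔ ∃ x ∈ X, x ⊆ A ∧ y ∈ J x)
    {f : X → Y} (hf : ∀ x, (f x : ZFSet.{u}) = J x) :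
    IsPredElementary {x | x ∈ A} B f := by
  rw [isPredElementary_iff]
  intro n φ xs
  -- Transfer is applied to the singleton of the code of `xs`, whose image contains the code of `f ∘
  -- xs`.
  have h1 := h.closed.singleton (h.closed.tup_mem xs)
  have h2 := h.map_mem (h.closed.tup_mem xs) h1 (ZFSet.mem_singleton.2 rfl)
  rw [h.map_tup] at h2
  have h3 : (fun i => J (xs i)) = fun i => (((f ∘ xs) i : Y) : ZFSet.{u}) := by
    funext i
    exact (hf _).symm
  rw [h3] at h2
  have key : ∀ {R : (Fin n → X) → Prop} {R' : (Fin n → Y) → Prop}, Transfers X Y J R R' →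
      R xs → R' (f ∘ xs) := by
    intro R R' hR hxs
    obtain ⟨ys, e, h4⟩ := hR _ h1 (fun t ht => ⟨xs, ZFSet.mem_singleton.1 ht, hxs⟩) _ h2
    rwa [h.tup_inj e]
  have := h.transfers_predRealize hA hB φ
  exact ⟨key this.1, fun h4 => by_contra fun h5 => key this.2 h5 h4⟩

theorem isElementary {f : X → Y} (hf : ∀ x, (f x : ZFSet.{u}) = J x) : IsElementary setLang f :=
  (h.isPredElementary (B := {y | ∃ x ∈ X, x ⊆ (∅ : ZFSet.{u}) ∧ y ∈ J x}) h.model.empty_mem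
    (fun _ _ => Iff.rfl) hf).isElementary

end IsFilteredMap

/-! ### Rank-to-rank maps -/

section RankLevel

variable {M : Set ZFSet.{u}} (hM : IsTransitiveZFModel M) {α β η δ : Ordinal.{u}} {x y : ZFSet.{u}}
include hM

theorem isTransClass_rankLevel : IsTransClass (rankLevel M α) := fun _ hx _ hy =>
  ⟨hM.transitive _ hx.1 _ hy, (ZFSet.isTransitive_vonNeumann α).mem_trans hy hx.2⟩

theorem isClosedIn_rankLevel (hα : Order.IsSuccLimit α) : IsClosedIn M (rankLevel M α) := by
  have h0 : ∀ {x}, x ∈ rankLevel M α ↔ x ∈ M ∧ x.rank < α := by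
    simp [rankLevel, ZFSet.mem_vonNeumann]
  have hs : ∀ {β}, β < α → Order.succ β < α := fun h => hα.succ_lt h
  refine ⟨fun x hx => hx.1, isTransClass_rankLevel hM, ?_, ?_, ?_, ?_, ?_⟩
  · rw [h0]
    exact ⟨hM.empty_mem, by simpa using hα.bot_lt⟩
  · intro x hx y hy hyx
    rw [h0] at hx ⊢
    exact ⟨hy, (ZFSet.rank_mono hyx).trans_lt hx.2⟩
  · intro x hx y hy
    rw [h0] at hx hy ⊢
    refine ⟨hM.pairing _ hx.1 _ hy.1, ?_⟩
    rw [ZFSet.rank_pair]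
    exact max_lt (hs hx.2) (hs hy.2)
  · intro x hx
    rw [h0] at hx ⊢
    exact ⟨hM.union _ hx.1, (ZFSet.rank_sUnion_le x).trans_lt hx.2⟩
  · intro x hx
    rw [h0] at hx ⊢
    refine ⟨hM.powIn_mem hx.1, (ZFSet.rank_mono ZFSet.sep_subset).trans_lt ?_⟩
    rw [ZFSet.rank_powerset]
    exact hs hx.2

theorem toZFSet_mem (hα : α.toZFSet ∈ M) (h : β ≤ α) : β.toZFSet ∈ M := by
  rcases h.eq_or_lt with rfl | h
  · exact hα
  · exact hM.transitive _ hα _ (Ordinal.toZFSet_mem_toZFSet_iff.2 h)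

theorem toZFSet_mem_rankLevel (hα : α.toZFSet ∈ M) (h : β < α) : β.toZFSet ∈ rankLevel M α :=
  ⟨toZFSet_mem hM hα h.le, by rwa [ZFSet.mem_vonNeumann, Ordinal.rank_toZFSet]⟩

theorem levelIn_mem_rankLevel (hα : α.toZFSet ∈ M) (h : β < α) : levelIn M β ∈ rankLevel M α :=
  ⟨levelIn_mem hM (toZFSet_mem hM hα h.le),
    ZFSet.mem_vonNeumann_of_subset ZFSet.sep_subset (ZFSet.vonNeumann_mem_of_lt h)⟩

omit hM in
theorem exists_mem_levelIn (hα : Order.IsSuccLimit α) (hx : x ∈ rankLevel M α) :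
    ∃ β < α, x ∈ levelIn M β := by
  refine ⟨Order.succ x.rank, hα.succ_lt (ZFSet.mem_vonNeumann.1 hx.2), mem_levelIn.2 ⟨hx.1, ?_⟩⟩
  exact ZFSet.mem_vonNeumann_succ x

omit hM in
theorem IsHierarchySet.pair_mem_iff {g v : ZFSet.{u}} (h : IsHierarchySet M α g) :
    ZFSet.pair β.toZFSet v ∈ g ↔ β < α ∧ v = levelIn M β := by
  rw [h]
  constructor
  · rintro ⟨ζ, hζ, e⟩
    obtain ⟨e1, rfl⟩ := ZFSet.pair_inj.1 e
    obtain rfl := Ordinal.toZFSet_injective e1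
    exact ⟨hζ, rfl⟩
  · rintro ⟨h, rfl⟩
    exact ⟨β, h, rfl⟩

/-- The extension of a map between rank levels to all sets. -/
noncomputable def extend (j : rankLevel M η → rankLevel M δ) (x : ZFSet.{u}) : ZFSet.{u} :=
  open Classical in if h : x ∈ rankLevel M η then j ⟨x, h⟩ else ∅

omit hM in
theorem extend_coe (j : rankLevel M η → rankLevel M δ) (x : rankLevel M η) :
    extend j x = j x := dif_pos x.2

omit hM in
theorem extend_eq (j : rankLevel M η → rankLevel M δ) (hx : x ∈ rankLevel M η) :
    extend j x = j ⟨x, hx⟩ := dif_pos hx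

variable {j : rankLevel M η → rankLevel M δ} (hj : IsSigma1Elementary j)
include hj

theorem preserves_d0 {n : ℕ} (P : (Fin n → ZFSet.{u}) → Prop) [D0 (n := 0) (fun v _ => P v)]
    (v : Fin n → ZFSet.{u}) (hv : ∀ k, v k ∈ rankLevel M η) (h : P v) :
    P (fun k => extend j (v k)) := by
  have := (hj.d0_iff (isTransClass_rankLevel hM) (isTransClass_rankLevel hM) P
    fun k => ⟨v k, hv k⟩).1 h
  simpa only [extend_eq j (hv _)] using this

theorem preservesClauses_extend : PreservesClauses (rankLevel M η) (extend j) := fun i v hv h =>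
  preserves_d0 hM hj i.Holds v hv h

/-- A rank-to-rank map that fixes the length of a filtration is a filtered map. -/
theorem isFilteredMap_extend (hη : Order.IsSuccLimit η) (hηM : η.toZFSet ∈ M)
    (hcof : IsMemCofinal j) {μ F : ZFSet.{u}} (hμ : μ ∈ rankLevel M η) (hμo : μ.IsOrdinal)
    (hjμ : extend j μ = μ) (hF : F ∈ M) (hfilt : IsFiltration (rankLevel M η) μ F) :
    IsFilteredMap M (rankLevel M η) (rankLevel M δ) (extend j) (levelIn M η) μ F where
  model := hM
  set_mem := levelIn_mem hM hηM
  mem_set := fun _ => mem_levelIn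
  closed := isClosedIn_rankLevel hM hη
  trans := isTransClass_rankLevel hM
  maps := fun x hx => by
    rw [extend_eq j hx]
    exact (j _).2
  clauses := preservesClauses_extend hM hj
  cofinal := fun y hy => by
    obtain ⟨x, hx⟩ := hcof ⟨y, hy⟩
    exact ⟨x, x.2, by rwa [extend_coe]⟩
  mu_mem := hμ
  ordinal := hμo
  map_mu := hjμ
  filt_mem := hF
  filt := hfilt

omit hj

/-- Proper initial segments of a function that witnesses the cofinality are bounded. -/
theorem IsCofIn.exists_bound {μ : Ordinal.{u}} (hηM : η.toZFSet ∈ M)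
    (h : IsCofIn M η μ) {f : ZFSet.{u}} (hf : f ∈ M) (hfun : ZFSet.IsFunc μ.toZFSet η.toZFSet f)
    {ξ : Ordinal.{u}} (hξ : ξ < μ) (hξM : ξ.toZFSet ∈ M) :
    ∃ β < η, ∀ ζ ≤ ξ, ∀ γ < η, ZFSet.pair ζ.toZFSet γ.toZFSet ∈ f → γ ≤ β := by
  have hg := hM.sep_mem (fun (v : Fin 2 → _) z => ∃ ζ ∈ v 0, ∃ γ ∈ v 1, z = ZFSet.pair ζ γ)
    ![ξ.toZFSet, η.toZFSet] (by simp [Fin.forall_fin_two, hξM, hηM]) hf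
  have hgf : ∀ {ζ γ : ZFSet.{u}}, ζ ∈ ξ.toZFSet → (ZFSet.pair ζ γ ∈ ZFSet.sep
      (fun z => ∃ ζ ∈ ξ.toZFSet, ∃ γ ∈ η.toZFSet, z = ZFSet.pair ζ γ) f ↔ ZFSet.pair ζ γ ∈ f) := by
    intro ζ γ hζ
    rw [ZFSet.mem_sep]
    refine ⟨fun h => h.1, fun h => ⟨h, ζ, hζ, γ, ?_, rfl⟩⟩
    exact (ZFSet.pair_mem_prod.1 (hfun.1 h)).2
  -- Otherwise the restriction of `f` to `ξ` would be cofinal, against the minimality of `μ`.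
  have h1 : ¬ ∀ β < η, ∃ ζ < ξ, ∃ γ < η, β ≤ γ ∧ ZFSet.pair ζ.toZFSet γ.toZFSet ∈ f := by
    intro h1
    refine hξ.not_ge (h.2 ⟨_, hg, ⟨fun z hz => ?_, fun z hz => ?_⟩, fun β hβ => ?_⟩)
    · obtain ⟨-, h2⟩ := ZFSet.mem_sep.1 hz
      exact ZFSet.mem_prod.2 h2
    · obtain ⟨w, hw, huniq⟩ := hfun.2 z (Ordinal.toZFSet_monotone hξ.le hz)
      exact ⟨w, (hgf hz).2 hw, fun y hy => huniq y ((hgf hz).1 hy)⟩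
    · obtain ⟨ζ, hζ, γ, hγ, hβγ, h2⟩ := h1 β hβ
      exact ⟨ζ, hζ, γ, hγ, hβγ, (hgf (Ordinal.toZFSet_mem_toZFSet_iff.2 hζ)).2 h2⟩
  push Not at h1
  obtain ⟨β, hβ, h1⟩ := h1
  obtain ⟨w, hw, huniq⟩ := hfun.2 ξ.toZFSet (Ordinal.toZFSet_mem_toZFSet_iff.2 hξ)
  obtain ⟨γ₀, hγ₀, rfl⟩ := Ordinal.mem_toZFSet_iff.1 (ZFSet.pair_mem_prod.1 (hfun.1 hw)).2
  -- The restriction to `ξ` omits the value at `ξ` itself, which is `γ₀`.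
  refine ⟨max β γ₀, max_lt hβ hγ₀, fun ζ hζ γ hγ h2 => ?_⟩
  rcases hζ.eq_or_lt with rfl | hζ
  · exact le_max_of_le_right (Ordinal.toZFSet_injective (huniq _ h2)).le
  · by_contra h3
    exact h1 ζ hζ γ hγ ((le_max_left _ _).trans (not_le.1 h3).le) h2

/-- A cofinal function from the cofinality `μ` of `η` yields a filtration of `V_η` of length `μ`. -/
theorem IsCofIn.exists_isFiltration {μ : Ordinal.{u}} (hη : Order.IsSuccLimit η)
    (hηM : η.toZFSet ∈ M) (h : IsCofIn M η μ) (hμη : μ < η) :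
    ∃ F ∈ M, IsFiltration (rankLevel M η) μ.toZFSet F := by
  obtain ⟨f, hf, hfun, hcof⟩ := h.1
  have hμM := toZFSet_mem hM hηM hμη.le
  have hEM := levelIn_mem hM hηM
  obtain ⟨g, hg, hg'⟩ := exists_isHierarchySet hM η hηM
  -- Stage `ξ` is `⋃_{ζ ≤ ξ} V_{f(ζ)}`; the union over `ζ ≤ ξ` is taken because `f` need not be
  -- increasing. The hierarchy `g` makes the condition `Δ₀`.
  obtain ⟨F, hF, hiff⟩ : ∃ F ∈ M, ∀ ξ < μ, ∀ x ∈ rankLevel M η, ZFSet.pair ξ.toZFSet x ∈ F ↔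
      ∃ ζ ≤ ξ, ∃ γ < η, ZFSet.pair ζ.toZFSet γ.toZFSet ∈ f ∧ x ∈ levelIn M γ := by
    refine ⟨_, hM.sep_mem (fun (v : Fin 5 → _) z => ∃ ξ ∈ v 0, ∃ x ∈ v 1, z = ZFSet.pair ξ x ∧
      ∃ ζ ∈ v 0, (ζ ∈ ξ ∨ ζ = ξ) ∧ ∃ γ ∈ v 2, ZFSet.pair ζ γ ∈ v 3 ∧
        ∃ w ∈ v 1, ZFSet.pair γ w ∈ v 4 ∧ x ∈ w)
      ![μ.toZFSet, levelIn M η, η.toZFSet, f, g]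
      (by simp [Fin.forall_fin_succ, hμM, hEM, hηM, hf, hg]) (hM.prod_mem hμM hEM), ?_⟩
    intro ξ hξ x hx
    simp only [ZFSet.mem_sep, Matrix.cons_val]
    constructor
    · rintro ⟨-, ξ', -, x', -, e, ζ, hζ, hζξ, γ, hγ, h1, w, -, h2, h3⟩
      obtain ⟨rfl, rfl⟩ := ZFSet.pair_inj.1 e
      obtain ⟨ζ, -, rfl⟩ := Ordinal.mem_toZFSet_iff.1 hζ
      obtain ⟨γ, hγη, rfl⟩ := Ordinal.mem_toZFSet_iff.1 hγ
      obtain ⟨-, rfl⟩ := hg'.pair_mem_iff.1 h2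
      refine ⟨ζ, ?_, γ, hγη, h1, h3⟩
      rw [Ordinal.toZFSet_mem_toZFSet_iff, Ordinal.toZFSet_injective.eq_iff] at hζξ
      exact le_iff_lt_or_eq.2 hζξ
    · rintro ⟨ζ, hζ, γ, hγ, h1, h2⟩
      have hξ' := Ordinal.toZFSet_mem_toZFSet_iff.2 hξ
      refine ⟨ZFSet.pair_mem_prod.2 ⟨hξ', mem_levelIn.2 hx⟩, _, hξ', x, mem_levelIn.2 hx, rfl,
        ζ.toZFSet, Ordinal.toZFSet_mem_toZFSet_iff.2 (hζ.trans_lt hξ), ?_,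
        γ.toZFSet, Ordinal.toZFSet_mem_toZFSet_iff.2 hγ, h1, _,
        mem_levelIn.2 (levelIn_mem_rankLevel hM hηM hγ), hg'.pair_mem_iff.2 ⟨hγ, rfl⟩, h2⟩
      rw [Ordinal.toZFSet_mem_toZFSet_iff, Ordinal.toZFSet_injective.eq_iff]
      exact le_iff_lt_or_eq.1 hζ
  refine ⟨F, hF, ⟨fun x hx => ?_, fun ξ hξ ζ hζ hξζ x hx h1 => ?_, fun ξ hξ => ?_⟩⟩
  · obtain ⟨β, hβ, hxβ⟩ := exists_mem_levelIn hη hx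
    obtain ⟨ξ, hξ, γ, hγ, hβγ, h1⟩ := hcof β hβ
    refine ⟨ξ.toZFSet, Ordinal.toZFSet_mem_toZFSet_iff.2 hξ, (hiff ξ hξ x hx).2
      ⟨ξ, le_rfl, γ, hγ, h1, mem_levelIn.2 ⟨hx.1, ?_⟩⟩⟩
    exact ZFSet.vonNeumann_subset_of_le hβγ (mem_levelIn.1 hxβ).2
  · obtain ⟨ξ, hξμ, rfl⟩ := Ordinal.mem_toZFSet_iff.1 hξ
    obtain ⟨ζ, hζμ, rfl⟩ := Ordinal.mem_toZFSet_iff.1 hζ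
    obtain ⟨ζ', h2, h3⟩ := (hiff ξ hξμ x hx).1 h1
    exact (hiff ζ hζμ x hx).2 ⟨ζ', h2.trans (Ordinal.toZFSet_mem_toZFSet_iff.1 hξζ).le, h3⟩
  · obtain ⟨ξ, hξμ, rfl⟩ := Ordinal.mem_toZFSet_iff.1 hξ
    obtain ⟨β, hβ, h1⟩ := h.exists_bound hM hηM hf hfun hξμ (toZFSet_mem hM hμM hξμ.le)
    refine ⟨_, levelIn_mem_rankLevel hM hηM hβ, fun x hx h2 => ?_⟩
    obtain ⟨ζ, hζ, γ, hγ, h3, h4⟩ := (hiff ξ hξμ x hx).1 h2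
    exact mem_levelIn.2 ⟨hx.1, ZFSet.vonNeumann_subset_of_le (h1 ζ hζ γ hγ h3) (mem_levelIn.1 h4).2⟩

include hj in
-- A set `x ⊆ A` in `V_η` is contained in some `A ∩ V_β`, and inclusion is preserved. This is the
-- form of `j(A)` that the transfer of the predicate uses.
theorem mem_imageOf_iff (hη : Order.IsSuccLimit η) (hηM : η.toZFSet ∈ M) {A : ZFSet.{u}} (hA : A ∈ M) :
    y ∈ imageOf j A ↔ ∃ x ∈ rankLevel M η, x ⊆ A ∧ y ∈ extend j x := by
  constructor
  · rintro ⟨β, hβ, x, hx, hy⟩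
    refine ⟨x, x.2, fun z hz => ?_, by rwa [extend_coe]⟩
    rw [hx] at hz
    exact (ZFSet.mem_inter.1 hz).1
  · rintro ⟨x, hx, hxA, hy⟩
    obtain ⟨β, hβ, hxβ⟩ := (mem_rankLevel_iff hM hx.1).1 hx
    have hAβ : A ∩ ZFSet.vonNeumann β = levelIn M β ∩ A := by
      ext z
      simp only [ZFSet.mem_inter, mem_levelIn, rankLevel, Set.mem_ofPred_eq]
      exact ⟨fun h => ⟨⟨hM.transitive _ hA _ h.1, h.2⟩, h.1⟩, fun h => ⟨h.2, h.1.2⟩⟩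
    have hmem : A ∩ ZFSet.vonNeumann β ∈ rankLevel M η := by
      rw [hAβ]
      exact (isClosedIn_rankLevel hM hη).inter hM (levelIn_mem_rankLevel hM hηM hβ) hA
    refine ⟨β, hβ, ⟨_, hmem⟩, rfl, ?_⟩
    rw [← extend_eq j hmem]
    have key : extend j x ⊆ extend j (A ∩ ZFSet.vonNeumann β) :=
      preserves_d0 hM hj (fun v : Fin 2 → ZFSet.{u} => v 0 ⊆ v 1) ![x, _]
        (by simp [Fin.forall_fin_two, hx, hmem]) fun z hz =>
          ZFSet.mem_inter.2 ⟨hxA hz, (mem_levelIn.1 (hxβ hz)).2⟩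
    exact key hy

end RankLevel

/-! ### The first-order definitions of the least length and the least critical point -/

section Definitions

variable {m : ℕ} (φ : setLang.Formula (Fin m ⊕ Fin 2))

/-- In `X`, the set `x` belongs to the `ξ`-th member of the sequence obtained from `F` by applying
the relation defined by `φ`. -/
def InStage (X : Set ZFSet.{u}) (p : Fin m → X) (F ξ x : X) : Prop :=
  ∃ y z : X, ZFSet.pair ξ y ∈ (F : ZFSet.{u}) ∧ DefRel φ X p y z ∧ (x : ZFSet.{u}) ∈ (z : ZFSet.{u})

/-- In `X`, the stages given by `p` and `F` form a filtration of `X` of length `a`. -/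
def IsLengthWith (X : Set ZFSet.{u}) (p : Fin m → X) (F a : X) : Prop :=
  (a : ZFSet.{u}).IsOrdinal ∧
  (∀ x : X, ∃ ξ : X, (ξ : ZFSet.{u}) ∈ (a : ZFSet.{u}) ∧
    ∀ y : X, (y : ZFSet.{u}) ∈ (x : ZFSet.{u}) → InStage φ X p F ξ y) ∧
  (∀ ξ ζ : X, (ξ : ZFSet.{u}) ∈ (a : ZFSet.{u}) → (ζ : ZFSet.{u}) ∈ (a : ZFSet.{u}) →
    (ξ : ZFSet.{u}) ∈ (ζ : ZFSet.{u}) → ∀ x : X, InStage φ X p F ξ x → InStage φ X p F ζ x) ∧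
  ∀ ξ : X, (ξ : ZFSet.{u}) ∈ (a : ZFSet.{u}) →
    ∃ w : X, ∀ x : X, InStage φ X p F ξ x → (x : ZFSet.{u}) ∈ (w : ZFSet.{u})

/-- In `X`, some choice of parameters gives a filtration of `X` of length `a`. -/
def IsLength (X : Set ZFSet.{u}) (a : X) : Prop :=
  ∃ p : Fin m → X, ∃ F : X, IsLengthWith φ X p F a

/-- In `X`, the least length of a filtration is `a`. -/
def IsLeastLength (X : Set ZFSet.{u}) (a : X) : Prop :=
  IsLength φ X a ∧ ∀ b : X, (b : ZFSet.{u}) ∈ (a : ZFSet.{u}) → ¬ IsLength φ X b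

/-- In `X`, the set `e` is transitive and closed under subsets, unordered pairs, unions and power
sets, and `F` is a filtration of `e` of length `μ`. -/
def IsFilteredSet (X : Set ZFSet.{u}) (e F μ : X) : Prop :=
  (∀ x : X, (x : ZFSet.{u}) ∈ (e : ZFSet.{u}) →
    (∀ y : X, (y : ZFSet.{u}) ∈ (x : ZFSet.{u}) → (y : ZFSet.{u}) ∈ (e : ZFSet.{u})) ∧
    (∀ y : X, (y : ZFSet.{u}) ⊆ (x : ZFSet.{u}) → (y : ZFSet.{u}) ∈ (e : ZFSet.{u})) ∧
    (∀ y : X, (y : ZFSet.{u}) ∈ (e : ZFSet.{u}) → ({(x : ZFSet.{u}), (y : ZFSet.{u})} : ZFSet.{u}) ∈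
      (e : ZFSet.{u})) ∧
    ZFSet.sUnion (x : ZFSet.{u}) ∈ (e : ZFSet.{u}) ∧
    (∃ z : X, (z : ZFSet.{u}) ∈ (e : ZFSet.{u}) ∧
      ∀ y : X, (y : ZFSet.{u}) ∈ (z : ZFSet.{u}) ↔ (y : ZFSet.{u}) ⊆ (x : ZFSet.{u})) ∧
    (∃ ξ : X, (ξ : ZFSet.{u}) ∈ (μ : ZFSet.{u}) ∧ ZFSet.pair ξ x ∈ (F : ZFSet.{u})) ∧
    ∀ ξ ζ : X, (ξ : ZFSet.{u}) ∈ (μ : ZFSet.{u}) → (ζ : ZFSet.{u}) ∈ (μ : ZFSet.{u}) →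
      (ξ : ZFSet.{u}) ∈ (ζ : ZFSet.{u}) → ZFSet.pair ξ x ∈ (F : ZFSet.{u}) →
      ZFSet.pair ζ x ∈ (F : ZFSet.{u})) ∧
  (∀ ξ : X, (ξ : ZFSet.{u}) ∈ (μ : ZFSet.{u}) → ∃ w : X, (w : ZFSet.{u}) ∈ (e : ZFSet.{u}) ∧
    ∀ x : X, (x : ZFSet.{u}) ∈ (e : ZFSet.{u}) → ZFSet.pair ξ x ∈ (F : ZFSet.{u}) →
      (x : ZFSet.{u}) ∈ (w : ZFSet.{u})) ∧
  (μ : ZFSet.{u}) ∈ (e : ZFSet.{u}) ∧ (μ : ZFSet.{u}).IsOrdinal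

/-- In `X`, the relation defined by `φ` is on `e` an `∈`-cofinal map into `X` that preserves the
clauses and fixes `μ`. -/
def IsEmbeddingOn (X : Set ZFSet.{u}) (p : Fin m → X) (e μ : X) : Prop :=
  (∀ x : X, (x : ZFSet.{u}) ∈ (e : ZFSet.{u}) → (∃ y : X, DefRel φ X p x y) ∧
    ∀ y z : X, DefRel φ X p x y → DefRel φ X p x z → y = z) ∧
  (∀ i : Clause, ∀ v w : Fin 6 → X, (∀ k, (v k : ZFSet.{u}) ∈ (e : ZFSet.{u})) →
    (∀ k, DefRel φ X p (v k) (w k)) → i.Holds (fun k => (v k : ZFSet.{u})) →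
    i.Holds (fun k => (w k : ZFSet.{u}))) ∧
  (∀ y : X, ∃ x z : X, (x : ZFSet.{u}) ∈ (e : ZFSet.{u}) ∧ DefRel φ X p x z ∧
    (y : ZFSet.{u}) ∈ (z : ZFSet.{u})) ∧
  DefRel φ X p μ μ

/-- In `X`, the ordinal `κ` is the critical point of a map with the properties above. -/
def IsCriticalPoint (X : Set ZFSet.{u}) (κ : X) : Prop :=
  ∃ p : Fin m → X, ∃ e F μ : X, IsFilteredSet X e F μ ∧ IsEmbeddingOn φ X p e μ ∧
    (κ : ZFSet.{u}) ∈ (e : ZFSet.{u}) ∧ (κ : ZFSet.{u}).IsOrdinal ∧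
    (∀ ξ : X, (ξ : ZFSet.{u}) ∈ (κ : ZFSet.{u}) → DefRel φ X p ξ ξ) ∧ ¬ DefRel φ X p κ κ

/-- In `X`, the ordinal `κ` is the least such critical point. -/
def IsLeastCriticalPoint (X : Set ZFSet.{u}) (κ : X) : Prop :=
  IsCriticalPoint φ X κ ∧ ∀ b : X, (b : ZFSet.{u}) ∈ (κ : ZFSet.{u}) → ¬ IsCriticalPoint φ X b

variable {α : Type}

instance (i : Clause) (g : Fin 6 → α) :
    Def (fun (X : Set ZFSet.{u}) (v : α → X) => i.Holds (fun k => (v (g k) : ZFSet.{u}))) :=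
  Def.of_d0 (fun v (_ : Fin 0 → ZFSet.{u}) => i.Holds v) g Fin.elim0

instance (g : Fin m → α) (a b c : α) :
    Def (fun (X : Set ZFSet.{u}) (v : α → X) =>
      InStage φ X (fun i => v (g i)) (v a) (v b) (v c)) := by
  unfold InStage
  infer_instance

instance (g : Fin m → α) (a b : α) :
    Def (fun (X : Set ZFSet.{u}) (v : α → X) =>
      IsLengthWith φ X (fun i => v (g i)) (v a) (v b)) := by
  unfold IsLengthWith
  infer_instance

instance (a : α) : Def (fun (X : Set ZFSet.{u}) (v : α → X) => IsLeastLength φ X (v a)) := by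
  unfold IsLeastLength IsLength
  infer_instance

instance (a b c : α) :
    Def (fun (X : Set ZFSet.{u}) (v : α → X) => IsFilteredSet X (v a) (v b) (v c)) := by
  unfold IsFilteredSet
  infer_instance

instance (g : Fin m → α) (a b : α) :
    Def (fun (X : Set ZFSet.{u}) (v : α → X) =>
      IsEmbeddingOn φ X (fun i => v (g i)) (v a) (v b)) := by
  unfold IsEmbeddingOn
  infer_instance

instance (a : α) : Def (fun (X : Set ZFSet.{u}) (v : α → X) => IsLeastCriticalPoint φ X (v a)) := by
  unfold IsLeastCriticalPoint IsCriticalPoint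
  infer_instance

/-- A nonempty class of elements of `X` has an `∈`-minimal element. -/
theorem exists_mem_minimal {X : Set ZFSet.{u}} (P : X → Prop) (h : ∃ x, P x) :
    ∃ x, P x ∧ ∀ y : X, (y : ZFSet.{u}) ∈ (x : ZFSet.{u}) → ¬ P y := by
  obtain ⟨x, hx⟩ := h
  have wf : WellFounded (fun a b : X => (a : ZFSet.{u}) ∈ (b : ZFSet.{u})) :=
    InvImage.wf (fun x : X => (x : ZFSet.{u})) ZFSet.mem_wf
  exact ⟨wf.min {x | P x} ⟨x, hx⟩, wf.min_mem _ _, fun y hy hP => wf.not_lt_min _ hP hy⟩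

end Definitions

/-! ### There is no least critical point in a rank level -/

section NoCriticalPoint

variable {M : Set ZFSet.{u}} (hM : IsTransitiveZFModel M) {δ : Ordinal.{u}}
  {m : ℕ} {φ : setLang.Formula (Fin m ⊕ Fin 2)}
include hM

/-- Subsets in `M` of elements of `V_δ` are again in `V_δ`, so `V_δ` and `M` agree about subsets and
power sets. -/
theorem IsFilteredSet.isClosedIn {e F μ : rankLevel M δ} (h : IsFilteredSet (rankLevel M δ) e F μ) :
    IsClosedIn M {x | x ∈ (e : ZFSet.{u})} := by
  have hδ := isTransClass_rankLevel hM (α := δ)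
  have hsub : ∀ x ∈ (e : ZFSet.{u}), ∀ y ∈ M, y ⊆ x → y ∈ rankLevel M δ := fun x hx y hy hyx =>
    ⟨hy, ZFSet.mem_vonNeumann_of_subset hyx (hδ _ e.2 _ hx).2⟩
  obtain ⟨h, -, hμ, -⟩ := h
  have h' := fun x (hx : x ∈ (e : ZFSet.{u})) => h ⟨x, hδ _ e.2 _ hx⟩ hx
  refine ⟨fun x hx => (hδ _ e.2 _ hx).1, fun x hx y hy => ?_, ?_, fun x hx y hy hyx => ?_,
    fun x hx y hy => ?_, fun x hx => (h' x hx).2.2.2.1, fun x hx => ?_⟩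
  · exact (h' x hx).1 ⟨y, hδ _ (hδ _ e.2 _ hx) _ hy⟩ hy
  -- `∅ ∈ e` because `μ ∈ e` and `e` is closed under subsets.
  · exact (h' _ hμ).2.1 ⟨∅, hsub _ hμ _ hM.empty_mem (ZFSet.empty_subset _)⟩ (ZFSet.empty_subset _)
  · exact (h' x hx).2.1 ⟨y, hsub x hx y hy hyx⟩ hyx
  · exact (h' x hx).2.2.1 ⟨y, hδ _ e.2 _ hy⟩ hy
  · obtain ⟨z, hz, hz'⟩ := (h' x hx).2.2.2.2.1
    suffices powIn M x = z by rwa [Set.mem_ofPred_eq, this]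
    ext y
    rw [mem_powIn]
    constructor
    · exact fun ⟨h1, h2⟩ => (hz' ⟨y, hsub x hx y h2 h1⟩).2 h1
    · intro hy
      have hyδ := hδ _ z.2 _ hy
      exact ⟨(hz' ⟨y, hyδ⟩).1 hy, hyδ.1⟩

theorem IsFilteredSet.isFiltration {e F μ : rankLevel M δ}
    (h : IsFilteredSet (rankLevel M δ) e F μ) :
    IsFiltration {x | x ∈ (e : ZFSet.{u})} μ F := by
  have hδ := isTransClass_rankLevel hM (α := δ)
  obtain ⟨h, hb, -, -⟩ := h
  have h' := fun x (hx : x ∈ (e : ZFSet.{u})) => h ⟨x, hδ _ e.2 _ hx⟩ hx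
  refine ⟨fun x hx => ?_, fun ξ hξ ζ hζ hξζ x hx h1 => ?_, fun ξ hξ => ?_⟩
  · obtain ⟨ξ, hξ, h1⟩ := (h' x hx).2.2.2.2.2.1
    exact ⟨ξ, hξ, h1⟩
  · exact (h' x hx).2.2.2.2.2.2 ⟨ξ, hδ _ μ.2 _ hξ⟩ ⟨ζ, hδ _ μ.2 _ hζ⟩ hξ hζ hξζ h1
  · obtain ⟨w, hw, h1⟩ := hb ⟨ξ, hδ _ μ.2 _ hξ⟩ hξ
    exact ⟨w, hw, fun x hx => h1 ⟨x, hδ _ e.2 _ hx⟩ hx⟩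

/-- The first-order conditions checked in `V_δ` are just those of the transfer argument. Thus every
map quantified over in `IsCriticalPoint` is fully elementary, although elementarity itself is not
first-order. -/
theorem IsEmbeddingOn.exists_isFilteredMap {p : Fin m → rankLevel M δ} {e F μ : rankLevel M δ}
    (h : IsFilteredSet (rankLevel M δ) e F μ) (h' : IsEmbeddingOn φ (rankLevel M δ) p e μ) :
    ∃ J : ZFSet.{u} → ZFSet.{u},
      IsFilteredMap M {x | x ∈ (e : ZFSet.{u})} (rankLevel M δ) J e μ F ∧
      ∀ x y : rankLevel M δ, (x : ZFSet.{u}) ∈ (e : ZFSet.{u}) →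
        (DefRel φ (rankLevel M δ) p x y ↔ J x = y) := by
  have hδ := isTransClass_rankLevel hM (α := δ)
  obtain ⟨h1, h2, h3, h4⟩ := h'
  have htot : ∀ x : ZFSet.{u}, ∃ y : ZFSet.{u}, ∀ hx : x ∈ (e : ZFSet.{u}),
      ∃ hy : y ∈ rankLevel M δ, DefRel φ (rankLevel M δ) p ⟨x, hδ _ e.2 _ hx⟩ ⟨y, hy⟩ := by
    intro x
    by_cases hx : x ∈ (e : ZFSet.{u})
    · obtain ⟨y, hy⟩ := (h1 ⟨x, hδ _ e.2 _ hx⟩ hx).1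
      exact ⟨y, fun _ => ⟨y.2, hy⟩⟩
    · exact ⟨∅, fun h => absurd h hx⟩
  choose J hJ using htot
  have hiff : ∀ x y : rankLevel M δ, (x : ZFSet.{u}) ∈ (e : ZFSet.{u}) →
      (DefRel φ (rankLevel M δ) p x y ↔ J x = y) := by
    intro x y hx
    obtain ⟨hJx, h5⟩ := hJ x hx
    constructor
    · intro h6
      exact congrArg Subtype.val ((h1 x hx).2 ⟨_, hJx⟩ y h5 h6)
    · intro h6
      rwa [show y = ⟨J x, hJx⟩ from Subtype.ext h6.symm]
  refine ⟨J, ⟨hM, e.2.1, fun _ => Iff.rfl, h.isClosedIn hM, hδ, fun x hx => (hJ x hx).1,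
    fun i v hv hi => ?_, fun y hy => ?_, h.2.2.1, h.2.2.2, ?_, F.2.1, h.isFiltration hM⟩, hiff⟩
  · exact h2 i (fun k => ⟨v k, hδ _ e.2 _ (hv k)⟩) (fun k => ⟨J (v k), (hJ _ (hv k)).1⟩) hv
      (fun k => (hJ _ (hv k)).2) hi
  · obtain ⟨x, z, hx, hxz, hyz⟩ := h3 ⟨y, hy⟩
    refine ⟨x, hx, ?_⟩
    rwa [(hiff x z hx).1 hxz]
  · exact (hiff μ μ h.2.2.1).1 h4

/-- The least critical point `κ` is definable in `V_δ` without parameters, so the elementary map `J`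
that witnesses it has `κ` in its range; but no map takes its own critical point as a value. -/
theorem not_isCriticalPoint (κ : rankLevel M δ) : ¬ IsCriticalPoint φ (rankLevel M δ) κ := by
  intro hκ
  obtain ⟨κ, hκ⟩ := exists_mem_minimal (IsCriticalPoint φ (rankLevel M δ)) ⟨κ, hκ⟩
  have hδ := isTransClass_rankLevel hM (α := δ)
  obtain ⟨p, e, F, μ, h1, h2, hκe, hκo, hfix, hmove⟩ := hκ.1
  obtain ⟨J, hJ, hiff⟩ := h2.exists_isFilteredMap hM h1
  have hel := hJ.isElementary (f := fun x => ⟨J x, hJ.maps x x.2⟩) fun _ => rfl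
  have hX := hJ.closed.trans
  obtain ⟨κ', hκ'⟩ := (hel.def_iff hX hδ
    (fun X (_ : Fin 0 → X) => ∃ κ, IsLeastCriticalPoint φ X κ) Fin.elim0).2 ⟨κ, hκ⟩
  have hleast := (hel.def_iff hX hδ
    (fun X (v : Fin 1 → X) => IsLeastCriticalPoint φ X (v 0)) ![κ']).1 hκ'
  change IsLeastCriticalPoint φ (rankLevel M δ) ⟨J κ', hJ.maps κ' κ'.2⟩ at hleast
  have ho : ∀ (X : Set ZFSet.{u}) (κ : X), IsLeastCriticalPoint φ X κ → (κ : ZFSet.{u}).IsOrdinal :=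
    fun X κ ⟨⟨_, _, _, _, _, _, _, h, _⟩, _⟩ => h
  have e1 : J κ' = κ := by
    rcases (ho _ _ hleast).mem_trichotomous hκo with h | h | h
    · exact absurd hleast.1 (hκ.2 _ h)
    · exact h
    · exact absurd hκ.1 (hleast.2 _ h)
  have hfix' : ∀ ξ ∈ (κ : ZFSet.{u}), J ξ = ξ := fun ξ hξ =>
    (hiff ⟨ξ, hδ _ κ.2 _ hξ⟩ ⟨ξ, hδ _ κ.2 _ hξ⟩ (hX _ hκe _ hξ)).1 (hfix ⟨ξ, hδ _ κ.2 _ hξ⟩ hξ)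
  rcases (ho _ _ hκ').mem_trichotomous hκo with h | h | h
  · rw [hfix' _ h] at e1
    exact ZFSet.mem_irrefl _ (e1 ▸ h)
  · rw [h] at e1
    exact hmove ((hiff κ κ hκe).2 e1)
  -- If `κ < κ'` then `J κ < J κ' = κ`, so `J` fixes `J κ`; but also `J (J κ) < J κ`.
  · have h3 := hJ.map_mem hκe κ'.2 h
    rw [e1] at h3
    have h4 := hJ.map_mem (hX _ hκe _ h3) hκe h3
    rw [hfix' _ h3] at h4
    exact ZFSet.mem_irrefl _ h4

end NoCriticalPoint

/-! ### Elementary rank-to-rank maps are not definable -/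

/-- A definable binary relation is defined by a formula with finitely many numbered parameters. -/
theorem exists_defRel_iff {X : Set ZFSet.{u}} {R : Set (X × X)}
    (h : (Set.univ : Set X).Definable₂ setLang R) :
    ∃ (m : ℕ) (φ : setLang.Formula (Fin m ⊕ Fin 2)) (p : Fin m → X),
      ∀ x y, DefRel φ X p x y ↔ (x, y) ∈ R := by
  obtain ⟨A, -, hA⟩ := Set.definable_iff_finitely_definable.1 h
  obtain ⟨φ, hφ⟩ := Set.definable_iff_exists_formula_sum.1 hA
  obtain ⟨m, ⟨e⟩⟩ := Finite.exists_equiv_fin A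
  refine ⟨m, φ.relabel (Sum.map e id), fun i => e.symm i, fun x y => ?_⟩
  have h1 := Set.ext_iff.1 hφ ![x, y]
  simp only [Set.mem_ofPred_eq, Matrix.cons_val] at h1
  rw [h1, DefRel, Formula.realize_relabel]
  refine iff_of_eq (congrArg _ (funext fun i => ?_))
  rcases i with i | i
  · simp
  · rfl

section Definable

variable {M : Set ZFSet.{u}} (hM : IsTransitiveZFModel M) {η δ : Ordinal.{u}}
  (hη : Order.IsSuccLimit η)
include hM

include hη in
/-- The cumulative hierarchy is a filtration of `V_η` of length `η`. -/
theorem exists_isFiltration_level (hηM : η.toZFSet ∈ M) :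
    ∃ F ∈ M, IsFiltration (rankLevel M η) η.toZFSet F ∧
      ∀ x ∈ rankLevel M η, ∃ ξ ∈ η.toZFSet, ∀ y ∈ x, ZFSet.pair ξ y ∈ F := by
  have hEM := levelIn_mem hM hηM
  obtain ⟨g, hg, hg'⟩ := exists_isHierarchySet hM η hηM
  obtain ⟨F, hF, hiff⟩ : ∃ F ∈ M, ∀ β < η, ∀ x ∈ rankLevel M η, ZFSet.pair β.toZFSet x ∈ F ↔
      x ∈ levelIn M β := by
    refine ⟨_, hM.sep_mem (fun (v : Fin 3 → _) z => ∃ β ∈ v 0, ∃ x ∈ v 1, z = ZFSet.pair β x ∧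
      ∃ w ∈ v 1, ZFSet.pair β w ∈ v 2 ∧ x ∈ w) ![η.toZFSet, levelIn M η, g]
      (by simp [Fin.forall_fin_succ, hηM, hEM, hg]) (hM.prod_mem hηM hEM), fun β hβ x hx => ?_⟩
    simp only [ZFSet.mem_sep, Matrix.cons_val]
    constructor
    · rintro ⟨-, β', -, x', -, e, w, -, h1, h2⟩
      obtain ⟨rfl, rfl⟩ := ZFSet.pair_inj.1 e
      rwa [(hg'.pair_mem_iff.1 h1).2] at h2
    · intro h
      have hβ' := Ordinal.toZFSet_mem_toZFSet_iff.2 hβ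
      exact ⟨ZFSet.pair_mem_prod.2 ⟨hβ', mem_levelIn.2 hx⟩, _, hβ', x, mem_levelIn.2 hx, rfl,
        _, mem_levelIn.2 (levelIn_mem_rankLevel hM hηM hβ), hg'.pair_mem_iff.2 ⟨hβ, rfl⟩, h⟩
  refine ⟨F, hF, ⟨fun x hx => ?_, fun ξ hξ ζ hζ hξζ x hx h1 => ?_, fun ξ hξ => ?_⟩, fun x hx => ?_⟩
  · obtain ⟨β, hβ, hxβ⟩ := exists_mem_levelIn hη hx
    exact ⟨β.toZFSet, Ordinal.toZFSet_mem_toZFSet_iff.2 hβ, (hiff β hβ x hx).2 hxβ⟩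
  · obtain ⟨β, hβ, rfl⟩ := Ordinal.mem_toZFSet_iff.1 hξ
    obtain ⟨γ, hγ, rfl⟩ := Ordinal.mem_toZFSet_iff.1 hζ
    rw [hiff _ hγ x hx, mem_levelIn]
    rw [hiff _ hβ x hx, mem_levelIn] at h1
    exact ⟨h1.1, ZFSet.vonNeumann_subset_of_le (Ordinal.toZFSet_mem_toZFSet_iff.1 hξζ).le h1.2⟩
  · obtain ⟨β, hβ, rfl⟩ := Ordinal.mem_toZFSet_iff.1 hξ
    exact ⟨_, levelIn_mem_rankLevel hM hηM hβ, fun x hx => (hiff β hβ x hx).1⟩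
  · obtain ⟨β, hβ, hxβ⟩ := exists_mem_levelIn hη hx
    refine ⟨β.toZFSet, Ordinal.toZFSet_mem_toZFSet_iff.2 hβ, fun y hy =>
      (hiff β hβ y (isTransClass_rankLevel hM _ hx _ hy)).2 (mem_levelIn.2 ?_)⟩
    exact isTransClass_rankLevel hM _ (mem_levelIn.1 hxβ) _ hy

variable {m : ℕ} {φ : setLang.Formula (Fin m ⊕ Fin 2)}

include hη in
/-- A filtration that is defined inside `V_η` is an element of `M`. -/
theorem IsLengthWith.exists_isFiltration (hηM : η.toZFSet ∈ M) {p : Fin m → rankLevel M η}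
    {F a : rankLevel M η} (h : IsLengthWith φ (rankLevel M η) p F a) :
    ∃ G ∈ M, G ⊆ levelIn M η ∧ IsFiltration (rankLevel M η) a G ∧
      ∀ x ∈ rankLevel M η, ∃ ξ ∈ (a : ZFSet.{u}), ∀ y ∈ x, ZFSet.pair ξ y ∈ G := by
  have hX := isTransClass_rankLevel hM (α := η)
  have hc := isClosedIn_rankLevel hM hη
  obtain ⟨G, hG, hGE, hiff⟩ : ∃ G ∈ M, G ⊆ levelIn M η ∧ ∀ ξ x : rankLevel M η,
      (ξ : ZFSet.{u}) ∈ (a : ZFSet.{u}) →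
      (ZFSet.pair ξ x ∈ G ↔ InStage φ (rankLevel M η) p F ξ x) := by
    -- The stages are definable over `V_η` from `p`, `F` and `a`, the last two occupying positions
    -- `m` and `m + 1`.
    refine ⟨_, sep_definable_mem hM (levelIn_mem hM hηM) (fun _ => mem_levelIn) hX
      (fun X (v : Fin (m + 2) → X) z => ∃ ξ x : X, (z : ZFSet.{u}) = ZFSet.pair ξ x ∧
        (ξ : ZFSet.{u}) ∈ (v (Fin.natAdd m 1) : ZFSet.{u}) ∧
        InStage φ X (fun i => v (Fin.castAdd 2 i)) (v (Fin.natAdd m 0)) ξ x)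
      (Fin.append p ![F, a]), ZFSet.sep_subset, fun ξ x hξ => ?_⟩
    simp only [ZFSet.mem_sep, Fin.append_left, Fin.append_right, Matrix.cons_val]
    constructor
    · rintro ⟨-, -, ξ', x', e, -, h1⟩
      obtain ⟨e1, e2⟩ := ZFSet.pair_inj.1 e
      rwa [Subtype.ext e1, Subtype.ext e2]
    · intro h1
      have hp := hc.pair ξ.2 x.2
      exact ⟨mem_levelIn.2 hp, hp, ξ, x, rfl, hξ, h1⟩
  have hcov : ∀ x ∈ rankLevel M η, ∃ ξ ∈ (a : ZFSet.{u}), ∀ y ∈ x, ZFSet.pair ξ y ∈ G := by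
    intro x hx
    obtain ⟨ξ, hξ, h1⟩ := h.2.1 ⟨x, hx⟩
    exact ⟨ξ, hξ, fun y hy => (hiff ξ ⟨y, hX _ hx _ hy⟩ hξ).2 (h1 _ hy)⟩
  refine ⟨G, hG, hGE, ⟨fun x hx => ?_, fun ξ hξ ζ hζ hξζ x hx h1 => ?_, fun ξ hξ => ?_⟩, hcov⟩
  -- A stage that includes `{x}` as a subset has `x` as an element.
  · obtain ⟨ξ, hξ, h1⟩ := hcov _ (hc.singleton hx)
    exact ⟨ξ, hξ, h1 x (by simp)⟩
  · exact (hiff ⟨ζ, hX _ a.2 _ hζ⟩ ⟨x, hx⟩ hζ).2 (h.2.2.1 ⟨ξ, hX _ a.2 _ hξ⟩ _ hξ hζ hξζ _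
      ((hiff ⟨ξ, hX _ a.2 _ hξ⟩ ⟨x, hx⟩ hξ).1 h1))
  · obtain ⟨w, h1⟩ := h.2.2.2 ⟨ξ, hX _ a.2 _ hξ⟩ hξ
    exact ⟨w, w.2, fun x hx h2 => h1 ⟨x, hx⟩ ((hiff ⟨ξ, hX _ a.2 _ hξ⟩ _ hξ).1 h2)⟩

/-! ### Ordinals and filtrations under a rank-to-rank map. -/

variable {j : rankLevel M η → rankLevel M δ} (hj : IsSigma1Elementary j)
include hj

theorem map_mem_map {x y : ZFSet.{u}} (hx : x ∈ rankLevel M η) (hy : y ∈ rankLevel M η)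
    (h : x ∈ y) : extend j x ∈ extend j y :=
  preserves_d0 hM hj (fun v : Fin 2 → ZFSet.{u} => v 0 ∈ v 1) ![x, y]
    (by simp [Fin.forall_fin_two, hx, hy]) h

theorem map_subset_map {x y : ZFSet.{u}} (hx : x ∈ rankLevel M η) (hy : y ∈ rankLevel M η)
    (h : x ⊆ y) : extend j x ⊆ extend j y :=
  preserves_d0 hM hj (fun v : Fin 2 → ZFSet.{u} => v 0 ⊆ v 1) ![x, y]
    (by simp [Fin.forall_fin_two, hx, hy]) h

theorem isOrdinal_map {x : ZFSet.{u}} (hx : x ∈ rankLevel M η) (h : x.IsOrdinal) :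
    (extend j x).IsOrdinal :=
  preserves_d0 hM hj (fun v : Fin 1 → ZFSet.{u} => (v 0).IsOrdinal) ![x] (by simpa using hx) h

/-- A rank-to-rank map does not decrease ordinals. -/
theorem map_notMem {x : ZFSet.{u}} (hx : x ∈ rankLevel M η) : extend j x ∉ x := by
  induction x using ZFSet.inductionOn with
  | _ x ih =>
  intro h
  have h1 := isTransClass_rankLevel hM _ hx _ h
  exact ih _ h h1 (map_mem_map hM hj h1 hx h)

variable (hδ : Order.IsSuccLimit δ) (hηδ : η < δ) (hδM : δ.toZFSet ∈ M) (hcof : IsMemCofinal j)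
  {p : Fin m → rankLevel M δ}
  (hφ : ∀ x y, DefRel φ (rankLevel M δ) p x y ↔ (x, y) ∈ graphOn j)

omit hM hj in
include hφ in
theorem defRel_iff_extend_eq (x y : rankLevel M δ) : DefRel φ (rankLevel M δ) p x y ↔
    (x : ZFSet.{u}) ∈ rankLevel M η ∧ extend j x = y := by
  rw [hφ]
  constructor
  · rintro ⟨x', e, rfl⟩
    change (x' : ZFSet.{u}) = (x : ZFSet.{u}) at e
    rw [← e, extend_coe]
    exact ⟨x'.2, rfl⟩
  · rintro ⟨hx, e⟩
    rw [extend_eq j hx] at e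
    exact ⟨⟨x, hx⟩, rfl, Subtype.ext e⟩

include hη hδ hηδ hδM hcof hφ in
/-- The image of a filtration of `V_η` is a filtration of `V_δ`. -/
theorem isLength_of_isFiltration {a : rankLevel M δ} (ha : (a : ZFSet.{u}).IsOrdinal)
    {F : ZFSet.{u}} (hF : F ∈ M) (h : IsFiltration (rankLevel M η) a F)
    (hcov : ∀ x ∈ rankLevel M η, ∃ ξ ∈ (a : ZFSet.{u}), ∀ y ∈ x, ZFSet.pair ξ y ∈ F) :
    IsLength φ (rankLevel M δ) a := by
  have hηM := toZFSet_mem hM hδM hηδ.le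
  have hX := isTransClass_rankLevel hM (α := η)
  have hY := isTransClass_rankLevel hM (α := δ)
  have hcX := isClosedIn_rankLevel hM hη
  have hcY := isClosedIn_rankLevel hM hδ
  have hE := levelIn_mem_rankLevel hM hδM hηδ
  have hmaps : ∀ {x}, x ∈ rankLevel M η → extend j x ∈ rankLevel M δ := fun hx => by
    rw [extend_eq j hx]
    exact (j _).2
  -- Each stage is bounded and so is an element of `V_η`, to which `j` can be applied.
  have hslice : ∀ ξ ∈ (a : ZFSet.{u}), ∃ s ∈ rankLevel M η,
      ∀ x ∈ rankLevel M η, x ∈ s ↔ ZFSet.pair ξ x ∈ F := by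
    intro ξ hξ
    obtain ⟨w, hw, h1⟩ := h.bdd ξ hξ
    refine ⟨_, hcX.sep hM (fun (v : Fin 2 → _) x => ZFSet.pair (v 0) x ∈ v 1) ![ξ, F]
      (by simp [Fin.forall_fin_two, hF, (hY _ a.2 _ hξ).1]) hw, fun x hx => ?_⟩
    simp only [ZFSet.mem_sep, Matrix.cons_val]
    exact ⟨fun h => h.2, fun h => ⟨h1 x hx h, h⟩⟩
  choose! s hs hsF using hslice
  -- The sequence of stages is separated with `F` as a parameter, not with the external function
  -- `s`, so it belongs to `V_δ`.
  obtain ⟨G, hG, hGiff⟩ : ∃ G ∈ rankLevel M δ, ∀ ξ ∈ (a : ZFSet.{u}), ∀ y,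
      ZFSet.pair ξ y ∈ G ↔ y = s ξ := by
    have haE := hcY.union a.2 hE
    refine ⟨_, hcY.sep hM (fun (v : Fin 3 → _) z => ∃ ξ ∈ v 0, ∃ y ∈ v 1, z = ZFSet.pair ξ y ∧
      ∀ x ∈ v 1, x ∈ y ↔ ZFSet.pair ξ x ∈ v 2) ![(a : ZFSet.{u}), levelIn M η, F]
      (by simp [Fin.forall_fin_succ, hF, a.2.1, hE.1]) (hcY.pow _ (hcY.pow _ haE)), ?_⟩
    intro ξ hξ y
    simp only [ZFSet.mem_sep, Matrix.cons_val]
    constructor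
    · rintro ⟨-, ξ', -, y', hy', e, h1⟩
      obtain ⟨rfl, rfl⟩ := ZFSet.pair_inj.1 e
      have hyX := mem_levelIn.1 hy'
      ext x
      constructor
      · intro hx
        have := hX _ hyX _ hx
        exact (hsF _ hξ x this).2 ((h1 x (mem_levelIn.2 this)).1 hx)
      · intro hx
        have := hX _ (hs _ hξ) _ hx
        exact (h1 x (mem_levelIn.2 this)).2 ((hsF _ hξ x this).1 hx)
    · rintro rfl
      have hsE := mem_levelIn.2 (hs ξ hξ)
      refine ⟨hM.pair_mem_powIn haE.1 (by simp [hξ]) (by simp [hsE]), ξ, hξ, _, hsE, rfl, ?_⟩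
      exact fun x hx => hsF ξ hξ x (mem_levelIn.1 hx)
  -- Stage `ξ` of the new filtration is `j (s ξ)`: the values are moved but the indices are not, so
  -- the length stays `a`.
  have hst : ∀ ξ x : rankLevel M δ, (ξ : ZFSet.{u}) ∈ (a : ZFSet.{u}) →
      (InStage φ (rankLevel M δ) p ⟨G, hG⟩ ξ x ↔ (x : ZFSet.{u}) ∈ extend j (s ξ)) := by
    intro ξ x hξ
    simp only [InStage, hGiff _ hξ, defRel_iff_extend_eq hφ]
    constructor
    · rintro ⟨y, z, e, ⟨-, e'⟩, hx⟩
      rwa [← e, e']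
    · intro hx
      have hsY : s ξ ∈ rankLevel M δ := hY _ hE _ (mem_levelIn.2 (hs ξ hξ))
      exact ⟨⟨s ξ, hsY⟩, ⟨_, hmaps (hs ξ hξ)⟩, rfl, ⟨hs ξ hξ, rfl⟩, hx⟩
  refine ⟨p, ⟨G, hG⟩, ha, fun x => ?_, fun ξ ζ hξ hζ hξζ x => ?_, fun ξ hξ => ?_⟩
  · obtain ⟨z, hz⟩ := hcof x
    rw [← extend_coe] at hz
    -- With `x ∈ j z` and `⋃ z` contained in one stage, `x` is contained in the image of that stage.
    -- This is why covering is required for subsets and not only for elements.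
    obtain ⟨ξ, hξ, h1⟩ := hcov _ (hcX.sUnion z z.2)
    refine ⟨⟨ξ, hY _ a.2 _ hξ⟩, hξ, fun y hy => (hst _ _ hξ).2 ?_⟩
    have key : ∀ b ∈ extend j z, ∀ c ∈ b, c ∈ extend j (s ξ) :=
      preserves_d0 hM hj (fun v : Fin 2 → ZFSet.{u} => ∀ b ∈ v 0, ∀ c ∈ b, c ∈ v 1) ![(z : ZFSet.{u}), s ξ]
        (by simp [Fin.forall_fin_two, hs ξ hξ]) fun b hb c hc =>
          (hsF ξ hξ c (hX _ (hX _ z.2 _ hb) _ hc)).2 (h1 c (ZFSet.mem_sUnion_of_mem hc hb))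
    exact key _ hz _ hy
  · rw [hst _ _ hξ, hst _ _ hζ]
    refine fun hx => map_subset_map hM hj (hs ξ hξ) (hs ζ hζ) (fun y hy => ?_) hx
    have hyX := hX _ (hs ξ hξ) _ hy
    exact (hsF ζ hζ y hyX).2 (h.mono ξ hξ ζ hζ hξζ y hyX ((hsF ξ hξ y hyX).1 hy))
  · exact ⟨⟨_, hmaps (hs ξ hξ)⟩, fun x => (hst ξ x hξ).1⟩

include hη hηδ hδM hcof in
/-- Some ordinal is moved by a cofinal rank-to-rank map. -/
theorem exists_ordinal_map_ne :
    ∃ κ : rankLevel M η, (κ : ZFSet.{u}).IsOrdinal ∧ extend j κ ≠ κ := by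
  by_contra! hfix
  have hηM := toZFSet_mem hM hδM hηδ.le
  -- Pick `z ∈ V_β` with `η ∈ j z` and `β < η`. The ordinals in `z` are below `β`, so those in `j z`
  -- are below `j β`; were `β` fixed, `η < β` would follow.
  obtain ⟨z, hz⟩ := hcof ⟨_, toZFSet_mem_rankLevel hM hδM hηδ⟩
  rw [← extend_coe] at hz
  obtain ⟨β, hβ, hzβ⟩ := exists_mem_levelIn hη z.2
  have hβX := toZFSet_mem_rankLevel hM hηM hβ
  have key : ∀ y ∈ extend j z, y.IsOrdinal → y ∈ extend j β.toZFSet :=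
    preserves_d0 hM hj (fun v : Fin 2 → ZFSet.{u} => ∀ y ∈ v 0, y.IsOrdinal → y ∈ v 1)
      ![(z : ZFSet.{u}), β.toZFSet] (by simp [Fin.forall_fin_two, hβX]) fun y hy ho => by
        have h1 := isTransClass_rankLevel hM _ (mem_levelIn.1 hzβ) _ hy
        have h2 := ZFSet.mem_vonNeumann.1 h1.2
        have h3 := ho.toZFSet_rank_eq
        rw [← h3]
        exact Ordinal.toZFSet_mem_toZFSet_iff.2 h2
  have h1 := key _ hz (ZFSet.isOrdinal_toZFSet η)
  rw [hfix ⟨_, hβX⟩ (ZFSet.isOrdinal_toZFSet β), Ordinal.toZFSet_mem_toZFSet_iff] at h1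
  exact hβ.not_gt h1

include hη hδ hηδ hδM hcof in
/-- The graph of a fully elementary cofinal rank-to-rank map is not definable. -/
theorem not_definable₂_graphOn (hel : IsElementary setLang j) :
    ¬ (Set.univ : Set (rankLevel M δ)).Definable₂ setLang (graphOn j) := by
  intro hdef
  obtain ⟨m, φ, p, hφ⟩ := exists_defRel_iff hdef
  have hηM := toZFSet_mem hM hδM hηδ.le
  have hX := isTransClass_rankLevel hM (α := η)
  have hY := isTransClass_rankLevel hM (α := δ)
  have hcX := isClosedIn_rankLevel hM hη
  have hcY := isClosedIn_rankLevel hM hδ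
  have hE := levelIn_mem_rankLevel hM hδM hηδ
  have hXY : ∀ {x}, x ∈ rankLevel M η → x ∈ rankLevel M δ := fun hx =>
    hY _ hE _ (mem_levelIn.2 hx)
  have hrel := defRel_iff_extend_eq hφ
  obtain ⟨F, hF, hfilt, hcov⟩ := exists_isFiltration_level hM hη hηM
  obtain ⟨a, ha⟩ := exists_mem_minimal (IsLength φ (rankLevel M δ))
    ⟨⟨_, toZFSet_mem_rankLevel hM hδM hηδ⟩, isLength_of_isFiltration hM hη hj hδ hηδ hδM hcof hφ
      (ZFSet.isOrdinal_toZFSet η) hF hfilt hcov⟩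
  -- The defining parameters of `j` need not lie in its range, so the notion of length quantifies
  -- them away and can be pulled back along `j`.
  obtain ⟨μ, hμ⟩ := (hel.def_iff hX hY
    (fun X (_ : Fin 0 → X) => ∃ a, IsLeastLength φ X a) Fin.elim0).2 ⟨a, ha⟩
  have hleast := (hel.def_iff hX hY
    (fun X (v : Fin 1 → X) => IsLeastLength φ X (v 0)) ![μ]).1 hμ
  change IsLeastLength φ (rankLevel M δ) (j μ) at hleast
  obtain ⟨p', F', hlen⟩ := hμ.1
  have hμo := hlen.1
  obtain ⟨G, hG, hGE, hfiltG, hcovG⟩ := hlen.exists_isFiltration hM hη hηM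
  have hlenY : IsLength φ (rankLevel M δ) ⟨μ, hXY μ.2⟩ :=
    isLength_of_isFiltration hM hη hj hδ hηδ hδM hcof hφ hμo hG hfiltG hcovG
  -- `j μ` is the least length in `V_δ` and `μ` is a length there, so `j μ ≤ μ`; the map does not
  -- decrease ordinals.
  have hjμ : extend j μ = μ := by
    rcases (isOrdinal_map hM hj μ.2 hμo).mem_trichotomous hμo with h | h | h
    · exact absurd h (map_notMem hM hj μ.2)
    · exact h
    · rw [extend_coe] at h
      exact absurd hlenY (hleast.2 ⟨μ, hXY μ.2⟩ h)
  obtain ⟨κ, ⟨hκo, hκ⟩, hmin⟩ := exists_mem_minimal _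
    (exists_ordinal_map_ne hM hη hj hηδ hδM hcof)
  have hlev : ∀ {x}, x ∈ rankLevel M η → x ∈ levelIn M η := fun hx => mem_levelIn.2 hx
  -- The map `j` itself witnesses a critical point, with `e = V_η`. The filtration `G` is available
  -- in `V_δ` because it is a subset of `V_η ∈ V_δ`.
  refine not_isCriticalPoint hM (φ := φ) ⟨κ, hXY κ.2⟩ ⟨p, ⟨_, hE⟩,
    ⟨G, hcY.subset _ hE _ hG hGE⟩, ⟨μ, hXY μ.2⟩, ⟨fun x hx => ?_, fun ξ hξ => ?_, hlev μ.2, hμo⟩,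
    ⟨fun x hx => ⟨?_, ?_⟩, fun i v w hv hvw hi => ?_, fun y => ?_, ?_⟩, hlev κ.2, hκo,
    fun ξ hξ => ?_, fun h => hκ ((hrel _ _).1 h).2⟩
  · have hx' := mem_levelIn.1 hx
    refine ⟨fun y hy => hlev (hX _ hx' _ hy), fun y hy => hlev (hcX.subset _ hx' _ y.2.1 hy),
      fun y hy => hlev (hcX.upair _ hx' _ (mem_levelIn.1 hy)), hlev (hcX.sUnion _ hx'),
      ⟨⟨_, hXY (hcX.pow _ hx')⟩, hlev (hcX.pow _ hx'), fun y => ?_⟩, ?_,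
      fun ξ ζ hξ hζ hξζ h => hfiltG.mono ξ hξ ζ hζ hξζ _ hx' h⟩
    · exact mem_powIn.trans (and_iff_left y.2.1)
    · obtain ⟨ξ, hξ, h⟩ := hfiltG.cover _ hx'
      exact ⟨⟨ξ, hY _ (hXY μ.2) _ hξ⟩, hξ, h⟩
  · obtain ⟨w, hw, h⟩ := hfiltG.bdd ξ hξ
    exact ⟨⟨w, hXY hw⟩, hlev hw, fun x hx => h x (mem_levelIn.1 hx)⟩
  · exact ⟨j ⟨x, mem_levelIn.1 hx⟩, (hrel _ _).2 ⟨mem_levelIn.1 hx, extend_eq j _⟩⟩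
  · intro y z hy hz
    exact Subtype.ext (((hrel _ _).1 hy).2.symm.trans ((hrel _ _).1 hz).2)
  · have := preservesClauses_extend hM hj i _ (fun k => mem_levelIn.1 (hv k)) hi
    simpa only [((hrel _ _).1 (hvw _)).2] using this
  · obtain ⟨x, hx⟩ := hcof y
    exact ⟨⟨x, hXY x.2⟩, j x, hlev x.2, (hrel _ _).2 ⟨x.2, extend_coe j x⟩, hx⟩
  · exact (hrel _ _).2 ⟨μ.2, hjμ⟩
  · have hξX := hX _ κ.2 _ hξ
    refine (hrel _ _).2 ⟨hξX, ?_⟩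
    by_contra h
    exact hmin ⟨ξ, hξX⟩ hξ ⟨hκo.mem hξ, h⟩

end Definable

end RankEmb

theorem theorem5p8 (M : Set ZFSet.{u}) (hM : RankEmb.IsTransitiveZFModel M)
    (η δ : Ordinal.{u}) (hη : Order.IsSuccLimit η) (hδ : Order.IsSuccLimit δ) (hηδ : η < δ)
    (hδM : δ.toZFSet ∈ M)
    (j : RankEmb.rankLevel M η → RankEmb.rankLevel M δ)
    (hj : RankEmb.IsSigma1Elementary j) (hcof : RankEmb.IsMemCofinal j) :
    (RankEmb.IsElementary RankEmb.setLang j →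
      ¬ (Set.univ : Set (RankEmb.rankLevel M δ)).Definable₂ RankEmb.setLang
        (RankEmb.graphOn j)) ∧
    (∀ μ : Ordinal.{u}, RankEmb.IsCofIn M η μ → μ < η →
      (∃ h : μ.toZFSet ∈ RankEmb.rankLevel M η,
        (j ⟨μ.toZFSet, h⟩ : ZFSet.{u}) = μ.toZFSet) →
      ∀ A ∈ M, (∀ x ∈ A, x ∈ RankEmb.rankLevel M η) →
        RankEmb.IsPredElementary {x | x ∈ A} (RankEmb.imageOf j A) j) := by
  open RankEmb in
  have hηM := toZFSet_mem hM hδM hηδ.le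
  refine ⟨not_definable₂_graphOn hM hη hj hδ hηδ hδM hcof,
    fun μ hμ hμη ⟨hμX, hjμ⟩ A hA _ => ?_⟩
  obtain ⟨F, hF, hfilt⟩ := hμ.exists_isFiltration hM hη hηM hμη
  exact (isFilteredMap_extend hM hj hη hηM hcof hμX (ZFSet.isOrdinal_toZFSet μ)
    ((extend_eq j hμX).trans hjμ) hF hfilt).isPredElementary hA
    (fun y _ => mem_imageOf_iff hM hj hη hηM hA) (fun x => (extend_coe j x).symm)
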